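/- **Theorem (Discrete Milling is $W[1]$-hard).** All graphs are finite and simple. Let $G=(V,E)$ be a graph, and for each vertex $x$ let $f_x : E(x)\times E(x)\to\{0,1\}$ be a turn-cost function, where $E(x)$ is the set of edges incident with $x$; $f_x(e,f)=1$ means that a walk entering $x$ on $e$ and leaving $x$ on $f$ makes a turn at $x$. The functions are *pairing* if for every $x$ and every $e\in E(x)$ there is at most one $f\in E(x)$ with $f_x(e,f)=0$, and *symmetric* if $f_x(e,f)=0$ implies $f_x(f,e)=0$. The number of turns of a walk $[x_0,\dots,x_l]$ (vertices and edges may be repeated) is $\sum_{i=1}^{l-1} f_{x_i}(x_{i-1}x_i,\,x_ix_{i+1})$. *Discrete Milling* is the following problem: given a graph $G$ with pairing and symmetric turn-cost functions and natural numbers $k,p$ such that the pathwidth of $G$ is at most $p$, decide whether $G$ has a walk that visits every vertex of $G$ and makes at most $k$ turns. Then Discrete Milling, parameterized by $(k,p)$, where $k$ is the number of turns and $p$ is the bound on the pathwidth, is hard for $W[1]$: every parameterized problem in $W[1]$ is fpt-reducible to it. Here an fpt-reduction from a problem $A$ with parameter $\kappa_A$ to a problem $B$ with parameter $\kappa_B$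 is a map $R$ from instances of $A$ to instances of $B$ such that $x$ is a yes-instance if and only if $R(x)$ is one, $\kappa_B(R(x))\le g(\kappa_A(x))$ for a computable function $g$, and $R(x)$ is computed in time $f(\kappa_A(x))\cdot(|x|+1)^{O(1)}$ for a computable function $f$. The parameter $(k,p)$ is measured by $k+p$. $W[1]$ is the class of parameterized problems that are fpt-reducible, for some constant $q$, to Weighted $q$-CNF Satisfiability: given a CNF formula with at most $q$ literals in each clause and a number $w$, the parameter, decide whether the formula has a satisfying assignment in which exactly $w$ variables are true. -/

import Mathlib

namespace Milling

/-! ### Machine model: random access machines with unit cost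

Programs are structured programs over natural-number registers `reg i` and
natural-number arrays `arr a`, with unit cost for every elementary instruction and every test.
The only arithmetic is addition and truncated subtraction, so that a run of `t` steps is
simulated by a Turing machine in time polynomial in `t` and the input length. -/

/-- The memory of a machine: registers and arrays (a program mentions finitely many of each). -/
@[ext]
structure State where
  reg : ℕ → ℕ
  arr : ℕ → ℕ → ℕ

/-- Write `v` into register `i`. -/
def State.setReg (s : State) (i v : ℕ) : State where
  reg := Function.update s.reg i v
  arr := s.arr

/-- Write `v` into cell `j` of array `a`. -/
def State.setArr (s : State) (a j v : ℕ) : State where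
  reg := s.reg
  arr := Function.update s.arr a (Function.update (s.arr a) j v)

/-- Programs. -/
inductive Prog where
  /-- do nothing -/
  | nop : Prog
  /-- `reg i := c` -/
  | const (i c : ℕ) : Prog
  /-- `reg i := reg j` -/
  | copy (i j : ℕ) : Prog
  /-- `reg i := reg j + reg k` -/
  | add (i j k : ℕ) : Prog
  /-- `reg i := reg j - reg k` (truncated at zero) -/
  | sub (i j k : ℕ) : Prog
  /-- `reg i := arr a (reg j)` -/
  | load (i a j : ℕ) : Prog
  /-- `arr a (reg i) := reg j` -/
  | store (a i j : ℕ) : Prog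
  /-- run `p`, then `q` -/
  | seq (p q : Prog) : Prog
  /-- if `reg i ≠ 0` then run `p` else run `q` -/
  | branch (i : ℕ) (p q : Prog) : Prog
  /-- as long as `reg i ≠ 0`, run `p` -/
  | loop (i : ℕ) (p : Prog) : Prog

/-- `Exec p s s' t`: started in memory `s`, the program `p` halts with memory `s'` after exactly
`t` steps. -/
inductive Exec : Prog → State → State → ℕ → Prop
  | nop (s : State) : Exec .nop s s 1
  | const (i c : ℕ) (s : State) : Exec (.const i c) s (s.setReg i c) 1
  | copy (i j : ℕ) (s : State) : Exec (.copy i j) s (s.setReg i (s.reg j)) 1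
  | add (i j k : ℕ) (s : State) : Exec (.add i j k) s (s.setReg i (s.reg j + s.reg k)) 1
  | sub (i j k : ℕ) (s : State) : Exec (.sub i j k) s (s.setReg i (s.reg j - s.reg k)) 1
  | load (i a j : ℕ) (s : State) : Exec (.load i a j) s (s.setReg i (s.arr a (s.reg j))) 1
  | store (a i j : ℕ) (s : State) : Exec (.store a i j) s (s.setArr a (s.reg i) (s.reg j)) 1
  | seq {p q : Prog} {s s' s'' : State} {t t' : ℕ} (hp : Exec p s s' t) (hq : Exec q s' s'' t') :
      Exec (.seq p q) s s'' (t + t')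
  | branch_true {i : ℕ} {p q : Prog} {s s' : State} {t : ℕ} (hi : s.reg i ≠ 0)
      (hp : Exec p s s' t) : Exec (.branch i p q) s s' (t + 1)
  | branch_false {i : ℕ} {p q : Prog} {s s' : State} {t : ℕ} (hi : s.reg i = 0)
      (hq : Exec q s s' t) : Exec (.branch i p q) s s' (t + 1)
  | loop_stop {i : ℕ} {p : Prog} {s : State} (hi : s.reg i = 0) : Exec (.loop i p) s s 1
  | loop_step {i : ℕ} {p : Prog} {s s' s'' : State} {t t' : ℕ} (hi : s.reg i ≠ 0)
      (hp : Exec p s s' t) (hl : Exec (.loop i p) s' s'' t') :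
      Exec (.loop i p) s s'' (t + t' + 1)

/-- The initial memory on input `w`: register `0` holds the length of `w`, array `0` holds the
bits of `w` (the bit `0` is stored as the number `1` and the bit `1` as the number `2`, so that a
written cell differs from a blank one), and everything else is zero. -/
def inputState (w : List Bool) : State where
  reg := fun i => if i = 0 then w.length else 0
  arr := fun a i => if a = 0 then (w[i]?).elim 0 (fun b => b.toNat + 1) else 0

/-- The word `w` is the output in memory `s`: register `0` holds its length and array `0` its
bits, stored as in the input (the contents of the other cells are irrelevant). -/
def State.HasOutput (s : State) (w : List Bool) : Prop :=
  s.reg 0 = w.length ∧ ∀ (i : ℕ) (b : Bool), w[i]? = some b → s.arr 0 i = b.toNat + 1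

/-! ### Parameterized problems, fpt-reductions -/

/-- A parameterized decision problem: instances, given to a machine as binary words, the
yes-instances, and the parameter. -/
structure ParamProblem where
  Inst : Type
  encode : Inst → List Bool
  encode_injective : Function.Injective encode
  Yes : Inst → Prop
  param : Inst → ℕ

/-- There is an fpt-reduction from `A` to `B`: a map `R` from instances of `A` to instances of `B`
that preserves the answer, is computed by one program in time
`f(κ) · (n + 1) ^ c`, where `n` is the input length and `κ` its parameter,
and whose new parameter is at most `g(κ)`; here `f` and `g` are computable. -/
def FPTReduces (A B : ParamProblem) : Prop :=
  ∃ (R : A.Inst → B.Inst) (M : Prog) (f g : ℕ → ℕ) (c : ℕ),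
    Computable f ∧ Computable g ∧
    (∀ x, A.Yes x ↔ B.Yes (R x)) ∧
    (∀ x, B.param (R x) ≤ g (A.param x)) ∧
    ∀ x, ∃ (s : State) (t : ℕ), Exec M (inputState (A.encode x)) s t ∧
      s.HasOutput (B.encode (R x)) ∧
      t ≤ f (A.param x) * ((A.encode x).length + 1) ^ c

/-! ### Encodings -/

/-- An encoding that can be decoded from the front of any longer word. -/
def PrefixInj {α : Type} (e : α → List Bool) : Prop :=
  ∀ a b s t, e a ++ s = e b ++ t → a = b ∧ s = t

theorem PrefixInj.injective {α : Type} {e : α → List Bool} (h : PrefixInj e) :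
    Function.Injective e := fun a b hab => (h a b [] [] (by rw [hab])).1

/-- A bit is written as itself. -/
def encBool (b : Bool) : List Bool := [b]

theorem prefixInj_encBool : PrefixInj encBool := by
  intro a b s t h
  simpa [encBool] using h

/-- A natural number is written in unary, `1 ... 1 0`. -/
def encNat (n : ℕ) : List Bool := List.replicate n true ++ [false]

theorem prefixInj_encNat : PrefixInj encNat := by
  intro a
  induction a with
  | zero =>
    intro b s t h
    cases b with
    | zero => simpa [encNat] using h
    | succ b => simp [encNat, List.replicate_succ] at h
  | succ a ih =>
    intro b s t h
    cases b with
    | zero => simp [encNat, List.replicate_succ] at h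
    | succ b =>
      have h' : encNat a ++ s = encNat b ++ t := by
        simpa [encNat, List.replicate_succ] using h
      obtain ⟨h1, h2⟩ := ih b s t h'
      exact ⟨by rw [h1], h2⟩

/-- A pair is written as the concatenation of its components. -/
def encPair {α β : Type} (e : α → List Bool) (e' : β → List Bool) (x : α × β) : List Bool :=
  e x.1 ++ e' x.2

theorem prefixInj_encPair {α β : Type} {e : α → List Bool} {e' : β → List Bool}
    (h : PrefixInj e) (h' : PrefixInj e') : PrefixInj (encPair e e') := by
  rintro ⟨a, b⟩ ⟨a', b'⟩ s t hst
  simp only [encPair, List.append_assoc] at hst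
  obtain ⟨h1, h2⟩ := h _ _ _ _ hst
  obtain ⟨h3, h4⟩ := h' _ _ _ _ h2
  exact ⟨by rw [h1, h3], h4⟩

/-- A list is written entry by entry, each entry preceded by the bit `1`, with a final `0`. -/
def encList {α : Type} (e : α → List Bool) : List α → List Bool
  | [] => [false]
  | a :: l => true :: (e a ++ encList e l)

theorem prefixInj_encList {α : Type} {e : α → List Bool} (h : PrefixInj e) :
    PrefixInj (encList e) := by
  intro a
  induction a with
  | nil =>
    intro b s t hst
    cases b with
    | nil => simpa [encList] using hst
    | cons b l => simp [encList] at hst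
  | cons a l ih =>
    intro b s t hst
    cases b with
    | nil => simp [encList] at hst
    | cons b l' =>
      simp only [encList, List.cons_append, List.append_assoc, List.cons.injEq, true_and] at hst
      obtain ⟨h1, h2⟩ := h _ _ _ _ hst
      obtain ⟨h3, h4⟩ := ih _ _ _ h2
      exact ⟨by rw [h1, h3], h4⟩

/-- An element of `Fin n` is written as a number. -/
def encFin {n : ℕ} (i : Fin n) : List Bool := encNat i

theorem prefixInj_encFin {n : ℕ} : PrefixInj (encFin (n := n)) := by
  intro a b s t h
  obtain ⟨h1, h2⟩ := prefixInj_encNat _ _ _ _ h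
  exact ⟨Fin.ext h1, h2⟩

/-- A table `x 0, ..., x (n - 1)` of known length `n` is written entry by entry. -/
def encTable {α : Type} (e : α → List Bool) {n : ℕ} (x : Fin n → α) : List Bool :=
  (List.finRange n).flatMap fun i => e (x i)

theorem prefixInj_encTable {α : Type} {e : α → List Bool} (h : PrefixInj e) {n : ℕ} :
    PrefixInj (encTable e (n := n)) := by
  intro x y s t hst
  have key : ∀ l : List (Fin n),
      (l.flatMap fun i => e (x i)) ++ s = (l.flatMap fun i => e (y i)) ++ t →
        (∀ i ∈ l, x i = y i) ∧ s = t := by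
    intro l
    induction l with
    | nil => intro hl; exact ⟨by simp, by simpa using hl⟩
    | cons i l ih =>
      intro hl
      simp only [List.flatMap_cons, List.append_assoc] at hl
      obtain ⟨h1, h2⟩ := h _ _ _ _ hl
      obtain ⟨h3, h4⟩ := ih h2
      exact ⟨by simpa using ⟨h1, h3⟩, h4⟩
  obtain ⟨h1, h2⟩ := key _ hst
  exact ⟨funext fun i => h1 i (List.mem_finRange i), h2⟩

/-! ### The class W[1] -/

/-- A propositional formula in conjunctive normal form with at most `q` literals in each clause,
over the variables `0, ..., vars - 1`, together with a weight. The literal `(i, true)` is the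
variable `i` and `(i, false)` is its negation. -/
structure CNFInst (q : ℕ) where
  vars : ℕ
  clauses : List (List (Fin vars × Bool))
  length_le : ∀ C ∈ clauses, C.length ≤ q
  weight : ℕ

/-- Some truth assignment makes exactly `weight` variables true and satisfies every clause. -/
def CNFInst.IsSatisfiable {q : ℕ} (I : CNFInst q) : Prop :=
  ∃ τ : Fin I.vars → Bool, (Finset.univ.filter fun i => τ i = true).card = I.weight ∧
    ∀ C ∈ I.clauses, ∃ l ∈ C, τ l.1 = l.2

def CNFInst.encode {q : ℕ} (I : CNFInst q) : List Bool :=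
  encNat I.vars ++ (encNat I.weight ++ encList (encList (encPair encFin encBool)) I.clauses)

theorem CNFInst.encode_injective {q : ℕ} : Function.Injective (CNFInst.encode (q := q)) := by
  rintro ⟨n, cs, hc, k⟩ ⟨n', cs', hc', k'⟩ h
  simp only [CNFInst.encode] at h
  obtain ⟨rfl, h1⟩ := prefixInj_encNat _ _ _ _ h
  obtain ⟨rfl, h2⟩ := prefixInj_encNat _ _ _ _ h1
  obtain rfl := (prefixInj_encList (prefixInj_encList
    (prefixInj_encPair prefixInj_encFin prefixInj_encBool))).injective h2
  rfl

/-- Weighted `q`-CNF satisfiability, parameterized by the weight. -/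
def weightedCNFSat (q : ℕ) : ParamProblem where
  Inst := CNFInst q
  encode := CNFInst.encode
  encode_injective := CNFInst.encode_injective
  Yes := CNFInst.IsSatisfiable
  param := CNFInst.weight

/-- The class W[1]: the problems that are fpt-reducible to weighted `q`-CNF satisfiability, for
some fixed `q`. -/
def InW1 (A : ParamProblem) : Prop := ∃ q : ℕ, FPTReduces A (weightedCNFSat q)

/-- Hardness for W[1] under fpt-reductions. -/
def IsW1Hard (B : ParamProblem) : Prop := ∀ A : ParamProblem, InW1 A → FPTReduces A B

/-! ### Pathwidth -/

/-- A path decomposition of `G`: bags indexed by the path `0, 1, ..., m`. -/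
structure PathDecomposition {V : Type} (G : SimpleGraph V) where
  m : ℕ
  bag : Fin (m + 1) → Finset V
  vertex_mem : ∀ v, ∃ i, v ∈ bag i
  edge_mem : ∀ u v, G.Adj u v → ∃ i, u ∈ bag i ∧ v ∈ bag i
  /-- the bags that contain a given vertex form a subpath -/
  interval : ∀ v i j k, i ≤ j → j ≤ k → v ∈ bag i → v ∈ bag k → v ∈ bag j

/-- The least `w` such that `G` has a path decomposition all of whose bags have at most `w + 1`
vertices. -/
noncomputable def pathwidth {V : Type} (G : SimpleGraph V) : ℕ :=
  sInf {w | ∃ D : PathDecomposition G, ∀ i, (D.bag i).card ≤ w + 1}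

/-! ### Milling -/

/-- The 0/1 turn-cost functions of a graph on `V`. For neighbours `u`, `v` of `x`, `f x u v` says
whether a turn is required at `x` (cost `1`) by a walk that enters `x` on the edge `ux` and departs
on the edge `xv`. The values at non-neighbours are irrelevant. -/
abbrev TurnCost (V : Type) : Type := V → V → V → Bool

/-- At each vertex `x`, each incident edge `xu` has at most one incident edge `xv` such that
`f x u v = 0`. -/
def IsPairing {V : Type} (G : SimpleGraph V) (f : TurnCost V) : Prop :=
  ∀ x u v w, G.Adj x u → G.Adj x v → G.Adj x w → f x u v = false → f x u w = false → v = w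

/-- If `f x u v = 0` then `f x v u = 0`. -/
def IsSymmetric {V : Type} (G : SimpleGraph V) (f : TurnCost V) : Prop :=
  ∀ x u v, G.Adj x u → G.Adj x v → f x u v = false → f x v u = false

/-- The turn cost of a sequence of vertices: the sum of the costs at its inner vertices. -/
def turnCost {V : Type} (f : TurnCost V) : List V → ℕ
  | u :: x :: v :: l => (f x u v).toNat + turnCost f (x :: v :: l)
  | _ => 0

/-- There is a walk that visits every vertex and makes at most `k` turns. -/
def HasCoveringWalk {V : Type} (G : SimpleGraph V) (f : TurnCost V) (k : ℕ) : Prop :=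
  ∃ (a b : V) (W : G.Walk a b), (∀ x, x ∈ W.support) ∧ turnCost f W.support ≤ k

/-- An instance of Discrete Milling: a finite simple graph with pairing and symmetric turn-cost
functions, a number `k` of turns, and a bound `p` on the pathwidth of the graph. -/
structure DiscreteMillingInst where
  n : ℕ
  G : SimpleGraph (Fin n)
  f : TurnCost (Fin n)
  pairing : IsPairing G f
  symmetric : IsSymmetric G f
  k : ℕ
  p : ℕ
  pathwidth_le : pathwidth G ≤ p

open Classical in
/-- The numbers of the instance in unary, the adjacency matrix, and the table of turn costs. -/
noncomputable def DiscreteMillingInst.encode (I : DiscreteMillingInst) : List Bool :=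
  encNat I.n ++ (encNat I.k ++ (encNat I.p ++
    (encTable (encTable encBool) (fun u v => decide (I.G.Adj u v)) ++
      encTable (encTable (encTable encBool)) I.f)))

theorem DiscreteMillingInst.encode_injective :
    Function.Injective DiscreteMillingInst.encode := by
  classical
  rintro ⟨n, G, f, h1, h2, k, p, h3⟩ ⟨n', G', f', h1', h2', k', p', h3'⟩ h
  simp only [DiscreteMillingInst.encode] at h
  obtain ⟨rfl, h⟩ := prefixInj_encNat _ _ _ _ h
  obtain ⟨rfl, h⟩ := prefixInj_encNat _ _ _ _ h
  obtain ⟨rfl, h⟩ := prefixInj_encNat _ _ _ _ h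
  obtain ⟨hG, h⟩ := prefixInj_encTable (prefixInj_encTable prefixInj_encBool) _ _ _ _ h
  obtain rfl := (prefixInj_encTable (prefixInj_encTable
    (prefixInj_encTable prefixInj_encBool))).injective h
  obtain rfl : G = G' := by
    ext u v
    have := congrFun (congrFun hG u) v
    simpa using this
  rfl

/-- Discrete Milling, parameterized by the pair `(k, p)`, that is, by `k + p`. -/
noncomputable def discreteMilling : ParamProblem where
  Inst := DiscreteMillingInst
  encode := DiscreteMillingInst.encode
  encode_injective := DiscreteMillingInst.encode_injective
  Yes := fun I => HasCoveringWalk I.G I.f I.k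
  param := fun I => I.k + I.p

end Milling

/-! A formula with `n` variables and weight `w` is turned into a set cover problem with budget `w +
1`, and the set cover problem into a milling problem in which each chosen set costs one turn.

Set cover (`cover_iff`). An assignment with `w` true variables is a sequence `0 < a_1 < ... < a_w <
n + 1`. It is encoded by `w + 1` sets `(i, a, b)`, one per gap between consecutive true variables.
The elements `(g, v)` with `g < w` and `v ≤ n + 1` are covered by `(g, a, b)` if `a < b ≤ v` and by
`(g + 1, a, b)` if `v < a`. In a cover by `w + 1` sets every index occurs exactly once, and the
element `(g, a_{g+1})` then forces `a_g < b_g ≤ a_{g+1}`: the sets form a chain. A clause is one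
more element, covered by the sets that imply one of its literals. A single set suffices for a
negative literal too, since it knows that everything strictly between `a` and `b` is false.

Milling (`hasCoveringWalk_iff`). Each set becomes a trail that makes no turn, starts and ends at a
hub, and passes through the vertices of its elements. One more such trail, the spine, passes through
all other vertices. After the spine, each chosen set costs the one turn at the hub that enters its
trail. Conversely, label every edge by its trail. A free passage preserves the label, so a walk with
`r` turns uses at most `r + 1` labels, one of which is the spine because vertex `1` meets no other
trail. The cells of the trails are numbered element by element along the spine, so a window sliding
along both halves of the spine is a path decomposition of width `9` (`pathwidth_millGraph_le`),
whatever the formula. The new parameter is therefore `w + 10`.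

Machine side. `PolyComp` is a class of functions computed in polynomial time, closed under
substitution and polynomially bounded recursion. Loops running as often as the value of a number are
affordable, since all values are polynomial in the input length. The formula is read by a finite
automaton (`parse_encode`), and every bit of the milling instance is a `PolyComp` function of its
position (`polyList_encode_millInst`). `FPTReduces.trans_polyList` composes this with the given
reduction to weighted satisfiability. -/

namespace Milling

section

/-! ### Functions computable on the machine in polynomial time -/

/-- The symbol that represents position `i` of the word `w` in memory (`0` past its end). -/
def sym (w : List Bool) (i : ℕ) : ℕ := (w[i]?).elim 0 (fun b => b.toNat + 1)

theorem sym_of_lt {w : List Bool} {i : ℕ} (h : i < w.length) : sym w i = w[i].toNat + 1 := by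
  simp [sym, h]

theorem sym_of_le {w : List Bool} {i : ℕ} (h : w.length ≤ i) : sym w i = 0 := by
  simp [sym, h]

theorem sym_le_two (w : List Bool) (i : ℕ) : sym w i ≤ 2 := by
  rcases lt_or_ge i w.length with h | h
  · rw [sym_of_lt h]; cases w[i] <;> simp
  · simp [sym_of_le h]

theorem State.HasOutput.arr_eq {s : State} {w : List Bool} (h : s.HasOutput w) {i : ℕ}
    (hi : i < w.length) : s.arr 0 i = sym w i := by
  rw [sym_of_lt hi]; exact h.2 i _ (by simp [hi])

/-- A type of tuples of natural numbers. -/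
class Ctx (Γ : Type) where
  size : ℕ
  var : Γ → ℕ → ℕ

instance : Ctx Unit := ⟨0, fun _ _ => 0⟩

instance {Γ : Type} [Ctx Γ] : Ctx (Γ × ℕ) :=
  ⟨Ctx.size Γ + 1, fun x i => if i = Ctx.size Γ then x.2 else Ctx.var x.1 i⟩

variable {Γ Δ : Type} [Ctx Γ] [Ctx Δ]

/-- `B` bounds the length of `w` and all entries of `x`. -/
def Bounded (w : List Bool) (x : Γ) (B : ℕ) : Prop :=
  w.length ≤ B ∧ ∀ i < Ctx.size Γ, Ctx.var x i ≤ B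

/-- Values polynomially bounded in the length of the word and the arguments. -/
def PolyBounded (F : List Bool → Γ → ℕ) : Prop :=
  ∃ c, ∀ w x B, Bounded w x B → F w x ≤ (B + 2) ^ c

/-- The entries of `x` are stored in the registers given by `loc`, below register `d`. -/
structure Fits (w : List Bool) (x : Γ) (loc : ℕ → ℕ) (d : ℕ) (s : State) : Prop where
  pos : 0 < d
  lt : ∀ i < Ctx.size Γ, loc i < d
  out : s.HasOutput w
  reg : ∀ i < Ctx.size Γ, s.reg (loc i) = Ctx.var x i

/-- From `s` the program runs at most `T` steps, leaves arrays and the registers below `d`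
unchanged and writes `v` to register `d`. -/
def Yields (p : Prog) (d : ℕ) (s : State) (v T : ℕ) : Prop :=
  ∃ s' t, Exec p s s' t ∧ t ≤ T ∧ s'.reg d = v ∧ (∀ r < d, s'.reg r = s.reg r) ∧ s'.arr = s.arr

/-- `F` is computed in polynomial time, with its arguments in arbitrary registers, the result in
register `d`, and using only registers from `d` on. -/
def PolyComp (F : List Bool → Γ → ℕ) : Prop :=
  PolyBounded F ∧ ∃ (P : (ℕ → ℕ) → ℕ → Prog) (c : ℕ), ∀ w x B, Bounded w x B →
    ∀ loc d s, Fits w x loc d s → Yields (P loc d) d s (F w x) ((B + 2) ^ c)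

/-! ### Bounds of the form `(B + 2) ^ c`: since the base is at least `2`, constants, sums and
products are absorbed by the exponent. -/

theorem le_pow_self_add_two (n B : ℕ) : n ≤ (B + 2) ^ n :=
  (Nat.lt_pow_self (by omega)).le

theorem add_le_pow {B p q a b : ℕ} (hp : p ≤ (B + 2) ^ a) (hq : q ≤ (B + 2) ^ b) :
    p + q ≤ (B + 2) ^ (a + b + 1) := by
  have h1 : (B + 2) ^ a ≤ (B + 2) ^ (a + b) := Nat.pow_le_pow_right (by omega) (by omega)
  have h2 : (B + 2) ^ b ≤ (B + 2) ^ (a + b) := Nat.pow_le_pow_right (by omega) (by omega)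
  rw [pow_succ]; nlinarith

theorem mul_le_pow {B p q a b : ℕ} (hp : p ≤ (B + 2) ^ a) (hq : q ≤ (B + 2) ^ b) :
    p * q ≤ (B + 2) ^ (a + b) := by
  rw [pow_add]; exact Nat.mul_le_mul hp hq

theorem le_pow_of_le {B p a c : ℕ} (hp : p ≤ (B + 2) ^ a) (h : a ≤ c) : p ≤ (B + 2) ^ c :=
  hp.trans (Nat.pow_le_pow_right (by omega) h)

/-- Polynomials compose: this is used whenever a program runs on arguments that were themselves
computed. -/
theorem pow_add_two_mono {B B' c e : ℕ} (h : B' ≤ (B + 2) ^ e) :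
    (B' + 2) ^ c ≤ (B + 2) ^ ((e + 2 + 1) * c) := by
  rw [pow_mul]; exact Nat.pow_le_pow_left (add_le_pow h (le_pow_self_add_two 2 B)) c

theorem PolyBounded.const (n : ℕ) : PolyBounded (fun (_ : List Bool) (_ : Γ) => n) :=
  ⟨n, fun _ _ B _ => le_pow_self_add_two n B⟩

theorem PolyBounded.add {F G : List Bool → Γ → ℕ} (hF : PolyBounded F) (hG : PolyBounded G) :
    PolyBounded (fun w x => F w x + G w x) := by
  obtain ⟨a, ha⟩ := hF
  obtain ⟨b, hb⟩ := hG
  exact ⟨_, fun w x B h => add_le_pow (ha w x B h) (hb w x B h)⟩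

theorem PolyBounded.mul {F G : List Bool → Γ → ℕ} (hF : PolyBounded F) (hG : PolyBounded G) :
    PolyBounded (fun w x => F w x * G w x) := by
  obtain ⟨a, ha⟩ := hF
  obtain ⟨b, hb⟩ := hG
  exact ⟨_, fun w x B h => mul_le_pow (ha w x B h) (hb w x B h)⟩

theorem PolyBounded.mono {F G : List Bool → Γ → ℕ} (hG : PolyBounded G)
    (h : ∀ w x, F w x ≤ G w x) : PolyBounded F := by
  obtain ⟨b, hb⟩ := hG
  exact ⟨b, fun w x B hB => (h w x).trans (hb w x B hB)⟩

/-! #### Running programs -/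

@[simp] theorem State.setReg_reg (s : State) (i v j : ℕ) :
    (s.setReg i v).reg j = if j = i then v else s.reg j := by
  simp [State.setReg, Function.update_apply]

@[simp] theorem State.setReg_arr (s : State) (i v : ℕ) : (s.setReg i v).arr = s.arr := rfl

theorem State.HasOutput.of_eq {s s' : State} {w : List Bool} (h : s.HasOutput w)
    (h0 : s'.reg 0 = s.reg 0) (ha : s'.arr = s.arr) : s'.HasOutput w := by
  unfold State.HasOutput at *
  rw [h0, ha]; exact h

theorem Fits.mono {w : List Bool} {x : Γ} {loc : ℕ → ℕ} {d d' : ℕ} {s s' : State}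
    (h : Fits w x loc d s) (hd : d ≤ d') (hr : ∀ r < d, s'.reg r = s.reg r)
    (ha : s'.arr = s.arr) : Fits w x loc d' s' where
  pos := h.pos.trans_le hd
  lt i hi := (h.lt i hi).trans_le hd
  out := h.out.of_eq (hr 0 h.pos) ha
  reg i hi := by rw [hr _ (h.lt i hi), h.reg i hi]

theorem Yields.of_exec {p : Prog} {d : ℕ} {s s' : State} {t v T : ℕ} (h : Exec p s s' t)
    (ht : t ≤ T) (hv : s'.reg d = v) (hr : ∀ r < d, s'.reg r = s.reg r)
    (ha : s'.arr = s.arr) : Yields p d s v T := ⟨s', t, h, ht, hv, hr, ha⟩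

theorem Yields.mono {p : Prog} {d : ℕ} {s : State} {v T T' : ℕ} (h : Yields p d s v T)
    (hT : T ≤ T') : Yields p d s v T' := by
  obtain ⟨s', t, h1, h2, h3⟩ := h
  exact ⟨s', t, h1, h2.trans hT, h3⟩

theorem PolyComp.congr {F G : List Bool → Γ → ℕ} (hF : PolyComp F)
    (h : ∀ w x, F w x = G w x) : PolyComp G := by
  have : F = G := by funext w x; exact h w x
  exact this ▸ hF

theorem PolyComp.const (n : ℕ) : PolyComp (fun (_ : List Bool) (_ : Γ) => n) := by
  refine ⟨.const n, fun _ d => .const d n, 1, fun w x B hB loc d s hs => ?_⟩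
  refine .of_exec (Exec.const d n s) (by simp) (by simp) ?_ rfl
  intro r hr; simp; omega

/-- Renaming of arguments. -/
theorem PolyComp.rename {F : List Bool → Δ → ℕ} (hF : PolyComp F) (σ : Γ → Δ) (ρ : ℕ → ℕ)
    (hρ : ∀ i < Ctx.size Δ, ρ i < Ctx.size Γ ∧ ∀ x : Γ, Ctx.var (σ x) i = Ctx.var x (ρ i)) :
    PolyComp (fun w x => F w (σ x)) := by
  obtain ⟨⟨a, ha⟩, P, c, hP⟩ := hF
  have key : ∀ w (x : Γ) B, Bounded w x B → Bounded w (σ x) B := fun w x B h =>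
    ⟨h.1, fun i hi => by rw [(hρ i hi).2]; exact h.2 _ (hρ i hi).1⟩
  refine ⟨⟨a, fun w x B h => ha w _ B (key w x B h)⟩, fun loc d => P (fun i => loc (ρ i)) d, c,
    fun w x B hB loc d s hs => hP w _ B (key w x B hB) _ d s ?_⟩
  exact ⟨hs.pos, fun i hi => hs.lt _ (hρ i hi).1, hs.out,
    fun i hi => by rw [(hρ i hi).2]; exact hs.reg _ (hρ i hi).1⟩

theorem PolyComp.last : PolyComp (fun (_ : List Bool) (x : Γ × ℕ) => x.2) := by
  have hv : ∀ (w : List Bool) (x : Γ × ℕ), Ctx.var x (Ctx.size Γ) = x.2 := fun w x => by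
    simp [Ctx.var]
  have hlt : Ctx.size Γ < Ctx.size (Γ × ℕ) := Nat.lt_succ_self _
  refine ⟨⟨1, fun w x B hB => ?_⟩, fun loc d => .copy d (loc (Ctx.size Γ)), 1,
    fun w x B hB loc d s hs => ?_⟩
  · have := hB.2 _ hlt
    rw [hv w] at this
    simp only [pow_one]; omega
  · refine .of_exec (Exec.copy d _ s) (by simp) ?_ ?_ rfl
    · simp [hs.reg _ hlt, hv w]
    · intro r hr; simp; omega

theorem PolyComp.weaken {F : List Bool → Γ → ℕ} (hF : PolyComp F) :
    PolyComp (fun w (x : Γ × ℕ) => F w x.1) :=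
  hF.rename (fun x : Γ × ℕ => x.1) id fun i hi =>
    ⟨Nat.lt_succ_of_lt hi, fun x => by simp [Ctx.var, hi.ne]⟩

theorem PolyComp.length : PolyComp (fun (w : List Bool) (_ : Γ) => w.length) := by
  refine ⟨⟨1, fun w x B hB => ?_⟩, fun loc d => .copy d 0, 1, fun w x B hB loc d s hs => ?_⟩
  · have := hB.1; simp only [pow_one]; omega
  · refine .of_exec (Exec.copy d 0 s) (by simp) (by simp [hs.out.1]) ?_ rfl
    intro r hr; simp; omega

/-- Compute `G`, then run a program that uses the result. -/
theorem PolyComp.bind {F : List Bool → Γ × ℕ → ℕ} {G : List Bool → Γ → ℕ} (hF : PolyComp F)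
    (hG : PolyComp G) : PolyComp (fun w x => F w (x, G w x)) := by
  obtain ⟨⟨a, ha⟩, P, c, hP⟩ := hF
  obtain ⟨⟨b, hb⟩, Q, e, hQ⟩ := hG
  -- One bound for the old entries, at most `B`, and the new one, at most `(B + 2) ^ b`.
  have key : ∀ w (x : Γ) B, Bounded w x B → Bounded w (x, G w x) ((B + 2) ^ (b + 1)) := by
    intro w x B hB
    have h1 : B ≤ (B + 2) ^ (b + 1) := by
      rw [pow_succ]; have := Nat.one_le_pow b (B + 2) (by omega); nlinarith
    refine ⟨hB.1.trans h1, fun i hi => ?_⟩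
    simp only [Ctx.var]
    split_ifs with h
    · exact (hb w x B hB).trans (Nat.pow_le_pow_right (by omega) (by omega))
    · exact (hB.2 i (by have : i < Ctx.size Γ + 1 := hi; omega)).trans h1
  refine ⟨⟨_, fun w x B hB => (ha w _ _ (key w x B hB)).trans (pow_add_two_mono le_rfl)⟩,
    fun loc d => .seq (Q loc d) (.seq
      (P (Function.update loc (Ctx.size Γ) d) (d + 1)) (.copy d (d + 1))),
    e + (((b + 1) + 2 + 1) * c + 1 + 1) + 1, fun w x B hB loc d s hs => ?_⟩
  obtain ⟨s1, t1, h1, ht1, hv1, hr1, ha1⟩ := hQ w x B hB loc d s hs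
  have hs1 : Fits w (x, G w x) (Function.update loc (Ctx.size Γ) d) (d + 1) s1 := by
    refine ⟨by omega, fun i hi => ?_, hs.out.of_eq (hr1 0 hs.pos) ha1, fun i hi => ?_⟩
    · by_cases h : i = Ctx.size Γ
      · simp [h]
      · have : i < Ctx.size Γ + 1 := hi
        have := hs.lt i (by omega)
        simp [h]; omega
    · by_cases h : i = Ctx.size Γ
      · simp [h, Ctx.var, hv1]
      · have : i < Ctx.size Γ + 1 := hi
        have hi' : i < Ctx.size Γ := by omega
        simp [h, Ctx.var, hr1 _ (hs.lt i hi'), hs.reg i hi']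
  obtain ⟨s2, t2, h2, ht2, hv2, hr2, ha2⟩ := hP w _ _ (key w x B hB) _ _ s1 hs1
  refine .of_exec (h1.seq (h2.seq (Exec.copy d (d + 1) s2))) ?_ ?_ ?_ ?_
  · refine add_le_pow ht1 (add_le_pow (ht2.trans (pow_add_two_mono le_rfl)) ?_)
    simp
  · simp [hv2]
  · intro r hr
    have h3 : r ≠ d := by omega
    simp [h3, hr2 r (by omega), hr1 r hr]
  · simp [ha2, ha1]

theorem PolyComp.binop (op : ℕ → ℕ → ℕ) (I : ℕ → ℕ → ℕ → Prog)
    (hI : ∀ i j k s, Exec (I i j k) s (s.setReg i (op (s.reg j) (s.reg k))) 1)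
    (hop : ∀ m n, op m n ≤ m + n) {F G : List Bool → Γ → ℕ} (hF : PolyComp F)
    (hG : PolyComp G) : PolyComp (fun w x => op (F w x) (G w x)) := by
  have hbase : PolyComp (fun (w : List Bool) (y : (Γ × ℕ) × ℕ) => op y.1.2 y.2) := by
    have hv : ∀ (y : (Γ × ℕ) × ℕ), Ctx.var y (Ctx.size Γ) = y.1.2 ∧
        Ctx.var y (Ctx.size Γ + 1) = y.2 := fun y => by simp [Ctx.var, Ctx.size]
    have hl : Ctx.size Γ < Ctx.size ((Γ × ℕ) × ℕ) := by simp only [Ctx.size]; omega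
    have hl' : Ctx.size Γ + 1 < Ctx.size ((Γ × ℕ) × ℕ) := by simp only [Ctx.size]; omega
    refine ⟨⟨2, fun w y B hB => ?_⟩,
      fun loc d => I d (loc (Ctx.size Γ)) (loc (Ctx.size Γ + 1)), 1,
      fun w y B hB loc d s hs => ?_⟩
    · have h1 := hB.2 _ hl
      have h2 := hB.2 _ hl'
      rw [(hv y).1] at h1
      rw [(hv y).2] at h2
      have := hop y.1.2 y.2
      nlinarith
    · refine .of_exec (hI d _ _ s) (by simp) ?_ ?_ rfl
      · simp [hs.reg _ hl, hs.reg _ hl', hv]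
      · intro r hr; simp; omega
  exact (hbase.bind (G := fun w y => G w y.1) hG.weaken).bind hF

theorem PolyComp.add {F G : List Bool → Γ → ℕ} (hF : PolyComp F) (hG : PolyComp G) :
    PolyComp (fun w x => F w x + G w x) :=
  .binop (· + ·) .add Exec.add (fun _ _ => le_rfl) hF hG

theorem PolyComp.sub {F G : List Bool → Γ → ℕ} (hF : PolyComp F) (hG : PolyComp G) :
    PolyComp (fun w x => F w x - G w x) :=
  .binop (· - ·) .sub Exec.sub (fun m n => by omega) hF hG

theorem PolyComp.ite_ne_zero {F G H : List Bool → Γ → ℕ} (hF : PolyComp F) (hG : PolyComp G)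
    (hH : PolyComp H) : PolyComp (fun w x => if F w x ≠ 0 then G w x else H w x) := by
  obtain ⟨-, P, a, hP⟩ := hF
  obtain ⟨hGb, Q, b, hQ⟩ := hG
  obtain ⟨hHb, R, c, hR⟩ := hH
  refine ⟨(hGb.add hHb).mono fun w x => by split_ifs <;> omega,
    fun loc d => .seq (P loc d) (.branch d (Q loc d) (R loc d)), a + b + c + 4,
    fun w x B hB loc d s hs => ?_⟩
  obtain ⟨s1, t1, h1, ht1, hv1, hr1, ha1⟩ := hP w x B hB loc d s hs
  have hs1 := hs.mono le_rfl hr1 ha1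
  have h11 : 1 ≤ (B + 2) ^ 1 := Nat.one_le_pow _ _ (by omega)
  by_cases h : F w x ≠ 0
  · obtain ⟨s2, t2, h2, ht2, hv2, hr2, ha2⟩ := hQ w x B hB loc d s1 hs1
    refine .of_exec (h1.seq (.branch_true (by rwa [hv1]) h2))
      (le_pow_of_le (add_le_pow ht1 (add_le_pow ht2 h11)) (by omega)) (by simp [h, hv2])
      (fun r hr => by rw [hr2 r hr, hr1 r hr]) (by rw [ha2, ha1])
  · obtain ⟨s2, t2, h2, ht2, hv2, hr2, ha2⟩ := hR w x B hB loc d s1 hs1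
    refine .of_exec (h1.seq (.branch_false (by simpa [hv1] using h) h2))
      (le_pow_of_le (add_le_pow ht1 (add_le_pow ht2 h11)) (by omega)) (by simp [h, hv2])
      (fun r hr => by rw [hr2 r hr, hr1 r hr]) (by rw [ha2, ha1])

/-- The program may run on memory left by another program, where cells past the end of the word hold
anything. The index is therefore compared with the length, by truncated subtraction, before the cell
is read. -/
theorem PolyComp.sym {F : List Bool → Γ → ℕ} (hF : PolyComp F) :
    PolyComp (fun w x => sym w (F w x)) := by
  obtain ⟨-, P, a, hP⟩ := hF
  refine ⟨(PolyBounded.const 2).mono fun w x => sym_le_two _ _,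
    fun loc d => .seq (P loc d) (.seq (.sub (d + 1) 0 d)
      (.branch (d + 1) (.load d 0 d) (.const d 0))), a + 4,
    fun w x B hB loc d s hs => ?_⟩
  obtain ⟨s1, t1, h1, ht1, hv1, hr1, ha1⟩ := hP w x B hB loc d s hs
  have hs1 := hs.mono le_rfl hr1 ha1
  have h3 : 1 + (1 + 1) ≤ (B + 2) ^ 3 := le_pow_self_add_two 3 B
  by_cases h : F w x < w.length
  · refine .of_exec (h1.seq ((Exec.sub (d + 1) 0 d s1).seq (.branch_true ?_ (Exec.load d 0 d _))))
      (le_pow_of_le (add_le_pow ht1 h3) (by omega)) ?_ ?_ (by simp [ha1])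
    · simp [hs1.out.1, hv1]; omega
    · simp [hv1, hs1.out.arr_eq h]
    · intro r hr
      have e1 : r ≠ d := by omega
      have e2 : r ≠ d + 1 := by omega
      simp [e1, e2, hr1 r hr]
  · refine .of_exec (h1.seq ((Exec.sub (d + 1) 0 d s1).seq (.branch_false ?_ (Exec.const d 0 _))))
      (le_pow_of_le (add_le_pow ht1 h3) (by omega)) ?_ ?_ (by simp [ha1])
    · simp [hs1.out.1, hv1]; omega
    · simp [sym_of_le (not_lt.1 h)]
    · intro r hr
      have e1 : r ≠ d := by omega
      have e2 : r ≠ d + 1 := by omega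
      simp [e1, e2, hr1 r hr]

/-! ### Counting loops and bounded recursion. -/

theorem Fits.push {w : List Bool} {x : Γ} {loc : ℕ → ℕ} {d : ℕ} {s : State}
    (h : Fits w x loc d s) {r v : ℕ} (hr : r < d) (hv : s.reg r = v) :
    Fits w (x, v) (Function.update loc (Ctx.size Γ) r) d s := by
  refine ⟨h.pos, fun i hi => ?_, h.out, fun i hi => ?_⟩
  · by_cases h' : i = Ctx.size Γ
    · simp [h', hr]
    · have : i < Ctx.size Γ + 1 := hi
      simpa [Function.update_apply, h'] using h.lt i (by omega)
  · by_cases h' : i = Ctx.size Γ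
    · simp [h', Ctx.var, hv]
    · have : i < Ctx.size Γ + 1 := hi
      simpa [Function.update_apply, h', Ctx.var] using h.reg i (by omega)

theorem Bounded.push {w : List Bool} {x : Γ} {B v : ℕ} (h : Bounded w x B) (hv : v ≤ B) :
    Bounded w (x, v) B := by
  refine ⟨h.1, fun i hi => ?_⟩
  simp only [Ctx.var]
  split_ifs with h'
  · exact hv
  · exact h.2 i (by have : i < Ctx.size Γ + 1 := hi; omega)

theorem Bounded.mono {w : List Bool} {x : Γ} {B B' : ℕ} (h : Bounded w x B) (hB : B ≤ B') :
    Bounded w x B' := ⟨h.1.trans hB, fun i hi => (h.2 i hi).trans hB⟩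

/-- Iterate a loop body; register `i` counts down. -/
theorem exec_loop {i : ℕ} {p : Prog} {T : ℕ} (Inv : ℕ → State → Prop) (n : ℕ)
    (hreg : ∀ k s, Inv k s → s.reg i = n - k)
    (hbody : ∀ k < n, ∀ s, Inv k s → ∃ s' t, Exec p s s' t ∧ t ≤ T ∧ Inv (k + 1) s')
    (s : State) (h0 : Inv 0 s) :
    ∃ s' t, Exec (.loop i p) s s' t ∧ t ≤ n * (T + 1) + 1 ∧ Inv n s' := by
  have key : ∀ m k, m + k = n → ∀ s, Inv k s →
      ∃ s' t, Exec (.loop i p) s s' t ∧ t ≤ m * (T + 1) + 1 ∧ Inv n s' := by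
    intro m
    induction m with
    | zero =>
      intro k hk s hs
      obtain rfl : k = n := by omega
      exact ⟨s, 1, by constructor; rw [hreg k s hs]; omega, by simp, hs⟩
    | succ m ih =>
      intro k hk s hs
      obtain ⟨s1, t1, h1, ht1, hi1⟩ := hbody k (by omega) s hs
      obtain ⟨s2, t2, h2, ht2, hi2⟩ := ih (k + 1) (by omega) s1 hi1
      exact ⟨s2, _, .loop_step (by rw [hreg k s hs]; omega) h1 h2, by
        rw [Nat.succ_mul]; omega, hi2⟩
  exact key n 0 (by omega) s h0

/-- Polynomially bounded recursion. -/
theorem PolyComp.recursion {N g : List Bool → Γ → ℕ} {h : List Bool → (Γ × ℕ) × ℕ → ℕ}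
    (φ : List Bool → Γ → ℕ → ℕ) (hN : PolyComp N) (hg : PolyComp g) (hh : PolyComp h)
    (hzero : ∀ w x, φ w x 0 = g w x) (hsucc : ∀ w x k, φ w x (k + 1) = h w ((x, k), φ w x k))
    (hb : ∃ c, ∀ w x B, Bounded w x B → ∀ k ≤ N w x, φ w x k ≤ (B + 2) ^ c) :
    PolyComp (fun w x => φ w x (N w x)) := by
  obtain ⟨b, hb⟩ := hb
  obtain ⟨⟨a', ha'⟩, P, a, hP⟩ := hN
  obtain ⟨-, Q, c, hQ⟩ := hg
  obtain ⟨-, R, e, hR⟩ := hh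
  refine ⟨⟨b, fun w x B hB => hb w x B hB _ le_rfl⟩, ?_⟩
  -- Register `d` counts down, `d + 1` holds the current value of the recursion, `d + 2` the index,
  -- `d + 3` the constant `1`; the workspace of the step function starts at `d + 4`.
  let body : (ℕ → ℕ) → ℕ → Prog := fun loc d =>
    .seq (R (Function.update (Function.update loc (Ctx.size Γ) (d + 2)) (Ctx.size Γ + 1) (d + 1))
      (d + 4)) (.seq (.copy (d + 1) (d + 4)) (.seq (.add (d + 2) (d + 2) (d + 3))
        (.sub d d (d + 3))))
  let E := ((a' + b + 1 + 1) + 2 + 1) * e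
  refine ⟨fun loc d => .seq (P loc d) (.seq (Q loc (d + 1)) (.seq (.const (d + 2) 0)
    (.seq (.const (d + 3) 1) (.seq (.loop d (body loc d)) (.copy d (d + 1)))))),
    a + c + a' + E + 40,
    fun w x B hB loc d s hs => ?_⟩
  obtain ⟨s1, t1, h1, ht1, hv1, hr1, ha1⟩ := hP w x B hB loc d s hs
  obtain ⟨s2, t2, h2, ht2, hv2, hr2, ha2⟩ := hQ w x B hB loc (d + 1) s1
    (hs.mono (by omega) hr1 ha1)
  set s4 := (s2.setReg (d + 2) 0).setReg (d + 3) 1 with hs4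
  let Inv : ℕ → State → Prop := fun k s' => s'.reg d = N w x - k ∧ s'.reg (d + 1) = φ w x k ∧
    s'.reg (d + 2) = k ∧ s'.reg (d + 3) = 1 ∧ (∀ r < d, s'.reg r = s.reg r) ∧ s'.arr = s.arr
  have hbody : ∀ k < N w x, ∀ s', Inv k s' → ∃ s'' t, Exec (body loc d) s' s'' t ∧
      t ≤ (B + 2) ^ E + 3 ∧ Inv (k + 1) s'' := by
    rintro k hk s' ⟨i1, i2, i3, i4, i5, i6⟩
    -- The index, the value and the old entries get a common bound; without `hb` the values could
    -- grow exponentially along the loop.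
    have hk1 : k ≤ (B + 2) ^ (a' + b + 1 + 1) := by
      have h1 := ha' w x B hB
      exact (hk.le.trans h1).trans (Nat.pow_le_pow_right (by omega) (by omega))
    have hk2 : φ w x k ≤ (B + 2) ^ (a' + b + 1 + 1) :=
      (hb w x B hB k hk.le).trans (Nat.pow_le_pow_right (by omega) (by omega))
    have hk3 : B ≤ (B + 2) ^ (a' + b + 1 + 1) := by
      rw [pow_succ]; have := Nat.one_le_pow (a' + b + 1) (B + 2) (by omega); nlinarith
    have hf : Fits w ((x, k), φ w x k) (Function.update (Function.update loc (Ctx.size Γ) (d + 2))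
        (Ctx.size Γ + 1) (d + 1)) (d + 4) s' :=
      (((hs.mono (d' := d + 4) (by omega) i5 i6).push (r := d + 2) (by omega) i3).push
        (r := d + 1) (by omega) i2)
    obtain ⟨s5, t5, h5, ht5, hv5, hr5, ha5⟩ := hR w _ _
      (((hB.mono hk3).push hk1).push hk2) _ _ s' hf
    refine ⟨_, _, h5.seq ((Exec.copy (d + 1) (d + 4) s5).seq
      ((Exec.add (d + 2) (d + 2) (d + 3) _).seq (Exec.sub d d (d + 3) _))), ?_, ?_⟩
    · have := ht5.trans (pow_add_two_mono (c := e) (le_refl ((B + 2) ^ (a' + b + 1 + 1))))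
      change _ ≤ (B + 2) ^ E at this
      omega
    · have e0 := hr5 d (by omega)
      have e2 := hr5 (d + 2) (by omega)
      have e3 := hr5 (d + 3) (by omega)
      refine ⟨?_, ?_, ?_, ?_, ?_, ?_⟩
      · simp [e0, e3, i1, i4]; omega
      · simp [hv5, hsucc]
      · simp [e2, e3, i3, i4]
      · simp [e3, i4]
      · intro r hr
        have n0 : r ≠ d := by omega
        have n1 : r ≠ d + 1 := by omega
        have n2 : r ≠ d + 2 := by omega
        simp [n0, n1, n2, hr5 r (by omega), i5 r hr]
      · simp [ha5, i6]
  have h0 : Inv 0 s4 := by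
    refine ⟨?_, ?_, ?_, ?_, ?_, ?_⟩
    · simp [hs4, hr2 d (by omega), hv1]
    · simp [hs4, hv2, hzero]
    · simp [hs4]
    · simp [hs4]
    · intro r hr
      have n1 : r ≠ d + 2 := by omega
      have n2 : r ≠ d + 3 := by omega
      simp [hs4, n1, n2, hr2 r (by omega), hr1 r hr]
    · simp [hs4, ha2, ha1]
  obtain ⟨s5, t5, h5, ht5, i1, i2, i3, i4, i5, i6⟩ := exec_loop (i := d) (T := (B + 2) ^ E + 3)
    Inv (N w x) (fun k s hk => hk.1) hbody s4 h0
  have h11 : 1 ≤ (B + 2) ^ 1 := Nat.one_le_pow _ _ (by omega)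
  have h44 : 4 ≤ (B + 2) ^ 4 := le_pow_self_add_two 4 B
  refine .of_exec (h1.seq (h2.seq ((Exec.const (d + 2) 0 s2).seq ((Exec.const (d + 3) 1 _).seq
    (h5.seq (Exec.copy d (d + 1) s5)))))) ?_ ?_ ?_ ?_
  · have h6 := ht5.trans (add_le_pow (mul_le_pow (ha' w x B hB)
      (show (B + 2) ^ E + 4 ≤ _ from add_le_pow le_rfl h44)) h11)
    refine le_pow_of_le (add_le_pow ht1 (add_le_pow ht2 (add_le_pow h11 (add_le_pow h11
      (add_le_pow h6 h11))))) (by omega)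
  · simp [i2]
  · intro r hr
    have n0 : r ≠ d := by omega
    simp [n0, i5 r hr]
  · simp [i6]

/-! ### Predicates and arithmetic obtained from bounded loops. -/

open Classical in
/-- Decidable in polynomial time. -/
def PolyPred (p : List Bool → Γ → Prop) : Prop := PolyComp (fun w x => if p w x then 1 else 0)

theorem PolyComp.ite {p : List Bool → Γ → Prop} [∀ w x, Decidable (p w x)]
    {F G : List Bool → Γ → ℕ} (hp : PolyPred p) (hF : PolyComp F) (hG : PolyComp G) :
    PolyComp (fun w x => if p w x then F w x else G w x) :=
  (PolyComp.ite_ne_zero hp hF hG).congr fun w x => by by_cases h : p w x <;> simp [h]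

theorem PolyPred.congr {p q : List Bool → Γ → Prop} (hp : PolyPred p)
    (h : ∀ w x, p w x ↔ q w x) : PolyPred q := by
  have : p = q := by funext w x; exact propext (h w x)
  exact this ▸ hp

theorem PolyPred.not {p : List Bool → Γ → Prop} (hp : PolyPred p) :
    PolyPred (fun w x => ¬ p w x) :=
  (PolyComp.ite_ne_zero hp (.const 0) (.const 1)).congr fun w x => by
    by_cases h : p w x <;> simp [h]

theorem PolyPred.and {p q : List Bool → Γ → Prop} (hp : PolyPred p) (hq : PolyPred q) :
    PolyPred (fun w x => p w x ∧ q w x) :=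
  (PolyComp.ite_ne_zero hp hq (.const 0)).congr fun w x => by
    by_cases h : p w x <;> by_cases h' : q w x <;> simp [h, h']

theorem PolyPred.or {p q : List Bool → Γ → Prop} (hp : PolyPred p) (hq : PolyPred q) :
    PolyPred (fun w x => p w x ∨ q w x) :=
  (PolyComp.ite_ne_zero hp (.const 1) hq).congr fun w x => by
    by_cases h : p w x <;> by_cases h' : q w x <;> simp [h, h']

theorem PolyPred.lt {F G : List Bool → Γ → ℕ} (hF : PolyComp F) (hG : PolyComp G) :
    PolyPred (fun w x => F w x < G w x) :=
  (PolyComp.ite_ne_zero (hG.sub hF) (.const 1) (.const 0)).congr fun w x => by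
    split_ifs <;> first | rfl | omega

theorem PolyPred.le {F G : List Bool → Γ → ℕ} (hF : PolyComp F) (hG : PolyComp G) :
    PolyPred (fun w x => F w x ≤ G w x) :=
  (PolyPred.lt hG hF).not.congr fun _ _ => not_lt

theorem PolyPred.eq {F G : List Bool → Γ → ℕ} (hF : PolyComp F) (hG : PolyComp G) :
    PolyPred (fun w x => F w x = G w x) :=
  ((PolyPred.le hF hG).and (PolyPred.le hG hF)).congr fun _ _ => le_antisymm_iff.symm

theorem PolyPred.ne {F G : List Bool → Γ → ℕ} (hF : PolyComp F) (hG : PolyComp G) :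
    PolyPred (fun w x => F w x ≠ G w x) := (PolyPred.eq hF hG).not

theorem PolyComp.sum {N : List Bool → Γ → ℕ} {F : List Bool → Γ → ℕ → ℕ} (hN : PolyComp N)
    (hF : PolyComp (fun w (y : Γ × ℕ) => F w y.1 y.2)) :
    PolyComp (fun w x => ∑ k ∈ Finset.range (N w x), F w x k) := by
  refine PolyComp.recursion (g := fun _ _ => 0) (h := fun w y => y.2 + F w y.1.1 y.1.2)
    (fun w x n => ∑ k ∈ Finset.range n, F w x k) hN (.const 0) (.add .last hF.weaken)
    (fun w x => by simp) (fun w x k => Finset.sum_range_succ _ _) ?_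
  obtain ⟨⟨a, ha⟩, -⟩ := hN
  obtain ⟨⟨b, hb⟩, -⟩ := hF
  refine ⟨a + (a + 1 + 2 + 1) * b, fun w x B hB k hk => ?_⟩
  have h1 : ∀ i ∈ Finset.range k, F w x i ≤ (B + 2) ^ ((a + 1 + 2 + 1) * b) := by
    intro i hi
    have hi : i < k := Finset.mem_range.1 hi
    have e1 : B ≤ (B + 2) ^ (a + 1) := by
      rw [pow_succ]; have := Nat.one_le_pow a (B + 2) (by omega); nlinarith
    have e2 : i ≤ (B + 2) ^ (a + 1) := le_pow_of_le (hi.le.trans (hk.trans (ha w x B hB))) (by omega)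
    exact (hb w (x, i) _ ((hB.mono e1).push e2)).trans (pow_add_two_mono le_rfl)
  refine (Finset.sum_le_card_nsmul _ _ _ h1).trans ?_
  rw [Finset.card_range, smul_eq_mul]
  exact mul_le_pow (hk.trans (ha w x B hB)) le_rfl

theorem PolyPred.exists_lt {N : List Bool → Γ → ℕ} {p : List Bool → Γ → ℕ → Prop}
    (hN : PolyComp N) (hp : PolyPred (fun w (y : Γ × ℕ) => p w y.1 y.2)) :
    PolyPred (fun w x => ∃ k < N w x, p w x k) := by
  classical
  refine (PolyPred.ne (PolyComp.sum (F := fun w x k => if p w x k then 1 else 0) hN ?_)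
    (.const 0)).congr fun w x => ?_
  · unfold PolyPred at hp
    exact hp.congr fun w x => by congr
  · simp

theorem PolyComp.mul {F G : List Bool → Γ → ℕ} (hF : PolyComp F) (hG : PolyComp G) :
    PolyComp (fun w x => F w x * G w x) :=
  (PolyComp.sum (F := fun w x _ => G w x) hF hG.weaken).congr fun w x => by simp

theorem PolyComp.div {F G : List Bool → Γ → ℕ} (hF : PolyComp F) (hG : PolyComp G) :
    PolyComp (fun w x => F w x / G w x) := by
  -- The quotient is the number of positive multiples of the divisor up to the dividend; the test `0
  -- < G w x` gives division by zero its value `0`.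
  refine (PolyComp.sum (F := fun w x k => if 0 < G w x ∧ (k + 1) * G w x ≤ F w x then 1 else 0)
    hF (.ite (.and (.lt (.const 0) hG.weaken)
      (.le (.mul (.add .last (.const 1)) hG.weaken) hF.weaken)) (.const 1) (.const 0))).congr
    fun w x => ?_
  rcases Nat.eq_zero_or_pos (G w x) with h | h
  · simp [h]
  · have : ((Finset.range (F w x)).filter
        fun k => 0 < G w x ∧ (k + 1) * G w x ≤ F w x) = Finset.range (F w x / G w x) := by
      ext k
      have := Nat.div_le_self (F w x) (G w x)
      simp only [Finset.mem_filter, Finset.mem_range, h, true_and, ← Nat.le_div_iff_mul_le h]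
      omega
    rw [← Finset.sum_filter, this]; simp

theorem PolyComp.mod {F G : List Bool → Γ → ℕ} (hF : PolyComp F) (hG : PolyComp G) :
    PolyComp (fun w x => F w x % G w x) :=
  (hF.sub (hG.mul (hF.div hG))).congr fun w x => by
    have := Nat.mod_add_div (F w x) (G w x); omega

/-! ### Substitution into functions of one, two or three numbers, in any context. -/

theorem PolyComp.comp {f : List Bool → ℕ → ℕ}
    (hf : PolyComp (fun w (y : Unit × ℕ) => f w y.2)) {F : List Bool → Γ → ℕ} (hF : PolyComp F) :
    PolyComp (fun w x => f w (F w x)) := by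
  refine PolyComp.bind (F := fun w y => f w y.2) (hf.rename (Γ := Γ × ℕ)
    (fun y => ((), y.2)) (fun i => i + Ctx.size Γ) fun i hi => ?_) hF
  have : i < 1 := hi
  obtain rfl : i = 0 := by omega
  exact ⟨by simp [Ctx.size], fun x => by simp [Ctx.var, Ctx.size]⟩

theorem PolyComp.comp₂ {f : List Bool → ℕ → ℕ → ℕ}
    (hf : PolyComp (fun w (y : (Unit × ℕ) × ℕ) => f w y.1.2 y.2)) {F G : List Bool → Γ → ℕ}
    (hF : PolyComp F) (hG : PolyComp G) : PolyComp (fun w x => f w (F w x) (G w x)) := by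
  refine PolyComp.bind (F := fun w y => f w (F w y.1) y.2) (PolyComp.bind
    (F := fun w y => f w y.2 y.1.2) (hf.rename (Γ := (Γ × ℕ) × ℕ)
      -- The outer binding pushes the last argument first, so the arguments lie in reverse order.
      (fun y => (((), y.2), y.1.2)) (fun i => Ctx.size Γ + (1 - i)) fun i hi => ?_) hF.weaken) hG
  have : i < 2 := hi
  obtain rfl | rfl : i = 0 ∨ i = 1 := by omega
  all_goals exact ⟨by simp [Ctx.size], fun x => by simp [Ctx.var, Ctx.size]⟩

theorem PolyComp.comp₃ {f : List Bool → ℕ → ℕ → ℕ → ℕ}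
    (hf : PolyComp (fun w (y : ((Unit × ℕ) × ℕ) × ℕ) => f w y.1.1.2 y.1.2 y.2))
    {F G H : List Bool → Γ → ℕ} (hF : PolyComp F) (hG : PolyComp G) (hH : PolyComp H) :
    PolyComp (fun w x => f w (F w x) (G w x) (H w x)) := by
  refine PolyComp.bind (F := fun w y => f w (F w y.1) (G w y.1) y.2) (PolyComp.bind
    (F := fun w y => f w (F w y.1.1) y.2 y.1.2) (PolyComp.bind
    (F := fun w y => f w y.2 y.1.2 y.1.1.2) (hf.rename (Γ := ((Γ × ℕ) × ℕ) × ℕ)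
      (fun y => ((((), y.2), y.1.2), y.1.1.2)) (fun i => Ctx.size Γ + (2 - i)) fun i hi => ?_)
      hF.weaken.weaken) hG.weaken) hH
  have : i < 3 := hi
  obtain rfl | rfl | rfl : i = 0 ∨ i = 1 ∨ i = 2 := by omega
  all_goals
    exact ⟨by simp [Ctx.size] <;> omega, fun x => by simp [Ctx.var, Ctx.size] <;> omega⟩

/-! ### Computable words -/

/-- The word-valued function `G` has computable length and symbols. -/
def PolyList (G : List Bool → List Bool) : Prop :=
  PolyComp (fun w (_ : Unit) => (G w).length) ∧
    PolyComp (fun w (y : Unit × ℕ) => sym (G w) y.2)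

theorem sym_append (u v : List Bool) (i : ℕ) :
    sym (u ++ v) i = if i < u.length then sym u i else sym v (i - u.length) := by
  unfold sym
  split_ifs with h
  · rw [List.getElem?_append_left h]
  · rw [List.getElem?_append_right (by omega)]

theorem PolyList.append {G H : List Bool → List Bool} (hG : PolyList G) (hH : PolyList H) :
    PolyList (fun w => G w ++ H w) := by
  refine ⟨(hG.1.add hH.1).congr fun w x => by simp, ?_⟩
  refine (PolyComp.ite (.lt .last hG.1.weaken) hG.2 (PolyComp.comp (f := fun w i => sym (H w) i)
    hH.2 (.sub .last hG.1.weaken))).congr fun w x => ?_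
  rw [sym_append]

theorem sym_encNat (n i : ℕ) : sym (encNat n) i = if i < n then 2 else if i = n then 1 else 0 := by
  unfold encNat
  rw [sym_append]
  simp only [List.length_replicate]
  split_ifs with h1 h2
  · simp [sym, h1]
  · simp [sym, h2]
  · rw [sym_of_le]; simp; omega

theorem length_encNat (n : ℕ) : (encNat n).length = n + 1 := by simp [encNat]

theorem PolyList.encNat {f : List Bool → ℕ} (hf : PolyComp (fun w (_ : Unit) => f w)) :
    PolyList (fun w => encNat (f w)) := by
  refine ⟨(hf.add (.const 1)).congr fun w x => (length_encNat _).symm, ?_⟩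
  refine (PolyComp.ite (.lt .last hf.weaken) (.const 2) (.ite (.eq .last hf.weaken) (.const 1)
    (.const 0))).congr fun w x => ?_
  rw [sym_encNat]

theorem getElem?_flatMap {α β : Type} (f : α → List β) (m : ℕ) (hf : ∀ a, (f a).length = m)
    (hm : 0 < m) (l : List α) (i : ℕ) :
    (l.flatMap f)[i]? = (l[i / m]?).bind fun a => (f a)[i % m]? := by
  induction l generalizing i with
  | nil => simp
  | cons a l ih =>
    rw [List.flatMap_cons]
    rcases lt_or_ge i m with h | h
    · rw [List.getElem?_append_left (by rw [hf]; exact h), Nat.div_eq_of_lt h, Nat.mod_eq_of_lt h]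
      simp
    · rw [List.getElem?_append_right (by rw [hf]; exact h), hf, ih]
      obtain ⟨j, rfl⟩ := Nat.exists_eq_add_of_le h
      have : (m + j) / m = j / m + 1 := by rw [Nat.add_div_left _ hm]
      simp [this]

theorem length_encTable {α : Type} (e : α → List Bool) (m : ℕ) (he : ∀ a, (e a).length = m)
    {n : ℕ} (x : Fin n → α) : (encTable e x).length = n * m := by
  simp [encTable, List.length_flatMap, he]

theorem sym_encTable {α : Type} (e : α → List Bool) (m : ℕ) (he : ∀ a, (e a).length = m)
    (hm : 0 < m) {n : ℕ} (x : Fin n → α) (i : ℕ) :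
    sym (encTable e x) i = if h : i / m < n then sym (e (x ⟨i / m, h⟩)) (i % m) else 0 := by
  unfold sym encTable
  rw [getElem?_flatMap _ m (fun a => he _) hm]
  split_ifs with h
  · simp [h]
  · simp [h]

/-- All rows have the same length, so a position determines its row and column by division with
remainder. -/
theorem PolyList.table₂ {n : List Bool → ℕ} {b : List Bool → ℕ → ℕ → Bool}
    (hn : PolyComp (fun w (_ : Unit) => n w))
    (hb : PolyPred (fun w (y : (Unit × ℕ) × ℕ) => b w y.1.2 y.2 = true)) :
    PolyList (fun w => encTable (encTable encBool) fun u v : Fin (n w) => b w u v) := by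
  have h1 : ∀ (k : ℕ) (x : Fin k → Bool), (encTable encBool x).length = k := fun k x => by
    rw [length_encTable encBool 1 (fun a => rfl)]; simp
  have hlen : ∀ w, (encTable (encTable encBool) fun u v : Fin (n w) => b w u v).length
      = n w * n w := fun w => length_encTable _ _ (h1 _) _
  refine ⟨(hn.mul hn).congr fun w x => (hlen w).symm, ?_⟩
  have hN : PolyComp (fun w (_ : Unit × ℕ) => n w) := hn.weaken
  have hb' : PolyComp (fun w (y : (Unit × ℕ) × ℕ) => (b w y.1.2 y.2).toNat) :=
    PolyComp.congr hb fun w y => by cases h : b w y.1.2 y.2 <;> simp [h]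
  refine (PolyComp.ite (.lt .last (hN.mul hN)) (.add (hb'.comp₂
    (f := fun w u v => (b w u v).toNat) (.div .last hN)
    (.mod .last hN)) (.const 1)) (.const 0)).congr fun w x => ?_
  split_ifs with h
  · have hpos : 0 < n w := by
      rcases Nat.eq_zero_or_pos (n w) with h0 | h0
      · simp [h0] at h
      · exact h0
    have h2 : x.2 / n w < n w := Nat.div_lt_of_lt_mul h
    have h3 : x.2 % n w < n w := Nat.mod_lt _ hpos
    rw [sym_encTable _ _ (h1 _) hpos, dif_pos h2, sym_encTable _ 1 (fun a => rfl) one_pos,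
      dif_pos (by simpa using h3)]
    simp only [Nat.div_one, Nat.mod_one]
    cases b w (x.2 / n w) (x.2 % n w) <;> simp [sym, encBool]
  · rw [sym_of_le]; rw [hlen]; omega

theorem PolyList.table₃ {n : List Bool → ℕ} {b : List Bool → ℕ → ℕ → ℕ → Bool}
    (hn : PolyComp (fun w (_ : Unit) => n w))
    (hb : PolyPred (fun w (y : ((Unit × ℕ) × ℕ) × ℕ) => b w y.1.1.2 y.1.2 y.2 = true)) :
    PolyList (fun w => encTable (encTable (encTable encBool))
      fun u v t : Fin (n w) => b w u v t) := by
  have h1 : ∀ (k : ℕ) (x : Fin k → Bool), (encTable encBool x).length = k := fun k x => by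
    rw [length_encTable encBool 1 (fun a => rfl)]; simp
  have h2 : ∀ (k : ℕ) (x : Fin k → Fin k → Bool),
      (encTable (encTable encBool) x).length = k * k := fun k x => length_encTable _ _ (h1 _) _
  have hlen : ∀ w, (encTable (encTable (encTable encBool))
      fun u v t : Fin (n w) => b w u v t).length = n w * (n w * n w) :=
    fun w => length_encTable _ _ (h2 _) _
  refine ⟨(hn.mul (hn.mul hn)).congr fun w x => (hlen w).symm, ?_⟩
  have hN : PolyComp (fun w (_ : Unit × ℕ) => n w) := hn.weaken
  have hb' : PolyComp (fun w (y : ((Unit × ℕ) × ℕ) × ℕ) => (b w y.1.1.2 y.1.2 y.2).toNat) :=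
    PolyComp.congr hb fun w y => by cases h : b w y.1.1.2 y.1.2 y.2 <;> simp [h]
  refine (PolyComp.ite (.lt .last (hN.mul (hN.mul hN))) (.add (hb'.comp₃
    (f := fun w u v t => (b w u v t).toNat)
    (.div .last (hN.mul hN)) (.div (.mod .last (hN.mul hN)) hN)
    (.mod (.mod .last (hN.mul hN)) hN)) (.const 1)) (.const 0)).congr fun w x => ?_
  split_ifs with h
  · have hpos : 0 < n w := by
      rcases Nat.eq_zero_or_pos (n w) with h0 | h0
      · simp [h0] at h
      · exact h0
    have h3 : x.2 / (n w * n w) < n w := Nat.div_lt_of_lt_mul (by rw [mul_comm]; exact h)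
    have h4 : x.2 % (n w * n w) < n w * n w := Nat.mod_lt _ (by positivity)
    have h5 := Nat.div_lt_of_lt_mul h4
    have h6 : x.2 % (n w * n w) % n w < n w := Nat.mod_lt _ hpos
    rw [sym_encTable _ _ (h2 _) (by positivity), dif_pos h3, sym_encTable _ _ (h1 _) hpos,
      dif_pos h5, sym_encTable _ 1 (fun a => rfl) one_pos, dif_pos (by simpa using h6)]
    simp only [Nat.div_one, Nat.mod_one]
    cases b w (x.2 / (n w * n w)) (x.2 % (n w * n w) / n w) (x.2 % (n w * n w) % n w) <;>
      simp [sym, encBool]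
  · rw [sym_of_le]; rw [hlen]; omega

end

/-! ### Programs that write a word, and composition of reductions -/

@[simp] theorem State.setArr_reg (s : State) (a j v : ℕ) : (s.setArr a j v).reg = s.reg := rfl

theorem State.setArr_arr (s : State) (a j v b i : ℕ) :
    (s.setArr a j v).arr b i = if b = a ∧ i = j then v else s.arr b i := by
  simp only [State.setArr, Function.update_apply]
  by_cases h : b = a
  · subst h; simp [Function.update_apply]
  · simp [h]

theorem PolyBounded.pow {Γ : Type} [Ctx Γ] {F : List Bool → Γ → ℕ} (hF : PolyBounded F)
    (e : ℕ) : PolyBounded (fun w x => F w x ^ e) := by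
  obtain ⟨a, ha⟩ := hF
  exact ⟨a * e, fun w x B h => by rw [pow_mul]; exact Nat.pow_le_pow_left (ha w x B h) e⟩

theorem PolyList.exists_program {G : List Bool → List Bool} (hG : PolyList G) :
    ∃ (M : Prog) (c : ℕ), ∀ w s, s.HasOutput w →
      ∃ s' t, Exec M s s' t ∧ t ≤ (w.length + 2) ^ c ∧ s'.HasOutput (G w) := by
  obtain ⟨⟨⟨a, ha⟩, P, b, hP⟩, -, Q, e, hQ⟩ := hG
  let T : ℕ → ℕ := fun n => ((n + 2) ^ (a + 1) + 2) ^ e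
  -- Each symbol may depend on the whole input, so the output is collected in array `1` and copied
  -- to array `0` only when complete. Register `1` counts down, `2` is the position, `3` holds `1`,
  -- `4` keeps the length, and the workspace starts at `5`.
  let body₁ : Prog := .seq (Q (fun _ => 2) 5) (.seq (.store 1 2 5) (.seq (.add 2 2 3) (.sub 1 1 3)))
  let body₂ : Prog := .seq (.load 5 1 2) (.seq (.store 0 2 5) (.seq (.add 2 2 3) (.sub 1 1 3)))
  obtain ⟨c, hc⟩ : PolyBounded (fun w (_ : Unit) => (w.length + 2) ^ b +
      ((w.length + 2) ^ a * (T w.length + 3 + 1) + ((w.length + 2) ^ a * 5 + 20))) := by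
    have h2 : PolyBounded (fun w (_ : Unit) => w.length + 2) := PolyComp.length.1.add (.const 2)
    have h3 := ((h2.pow (a + 1)).add (.const 2)).pow e
    exact (h2.pow b).add (((h2.pow a).mul ((h3.add (.const 3)).add (.const 1))).add
      (((h2.pow a).mul (.const 5)).add (.const 20)))
  refine ⟨.seq (P (fun _ => 0) 1) (.seq (.copy 4 1) (.seq (.const 2 0) (.seq (.const 3 1)
    (.seq (.loop 1 body₁) (.seq (.copy 1 4) (.seq (.const 2 0) (.seq (.loop 1 body₂)
    (.copy 0 4)))))))), c, fun w s hs => ?_⟩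
  have hB : Bounded w () w.length := ⟨le_rfl, fun i hi => absurd hi (Nat.not_lt_zero i)⟩
  have hlen := ha w () _ hB
  obtain ⟨s1, t1, h1, ht1, hv1, hr1, ha1⟩ := hP w () _ hB (fun _ => 0) 1 s
    ⟨one_pos, fun i hi => absurd hi (Nat.not_lt_zero i), hs,
      fun i hi => absurd hi (Nat.not_lt_zero i)⟩
  simp only at hv1 hlen
  have hout1 := hs.of_eq (hr1 0 one_pos) ha1
  set s4 := ((s1.setReg 4 (s1.reg 1)).setReg 2 0).setReg 3 1 with hs4
  let Inv₁ : ℕ → State → Prop := fun k s' => s'.reg 1 = (G w).length - k ∧ s'.reg 2 = k ∧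
    s'.reg 3 = 1 ∧ s'.reg 4 = (G w).length ∧ s'.HasOutput w ∧ ∀ i < k, s'.arr 1 i = sym (G w) i
  have hbody₁ : ∀ k < (G w).length, ∀ s', Inv₁ k s' →
      ∃ s'' t, Exec body₁ s' s'' t ∧ t ≤ T w.length + 3 ∧ Inv₁ (k + 1) s'' := by
    rintro k hk s' ⟨i1, i2, i3, i4, i5, i6⟩
    have hBk : Bounded w ((), k) ((w.length + 2) ^ (a + 1)) := by
      refine (hB.mono ?_).push ((hk.le.trans hlen).trans
        (Nat.pow_le_pow_right (by omega) (by omega)))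
      rw [pow_succ]; have := Nat.one_le_pow a (w.length + 2) (by omega); nlinarith
    obtain ⟨s5, t5, h5, ht5, hv5, hr5, ha5⟩ := hQ w ((), k) _ hBk (fun _ => 2) 5 s'
      ⟨by omega, fun _ _ => by omega, i5, fun i hi => by
        have : i < 1 := hi
        obtain rfl : i = 0 := by omega
        simp [i2, Ctx.var, Ctx.size]⟩
    simp only at hv5
    refine ⟨_, _, h5.seq ((Exec.store 1 2 5 s5).seq ((Exec.add 2 2 3 _).seq (Exec.sub 1 1 3 _))),
      by change _ ≤ T w.length at ht5; omega, ?_⟩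
    have e1 := hr5 1 (by omega)
    have e2 := hr5 2 (by omega)
    have e3 := hr5 3 (by omega)
    refine ⟨?_, ?_, ?_, ?_, ⟨?_, fun i x hi => ?_⟩, fun i hi => ?_⟩
    · simp [e1, e3, i1, i3]; omega
    · simp [e2, e3, i2, i3]
    · simp [e3, i3]
    · simp [hr5 4 (by omega), i4]
    · simpa [hr5 0 (by omega)] using i5.1
    · simpa [State.setArr_arr, ha5] using i5.2 i x hi
    · simp only [State.setReg_arr, State.setArr_arr, true_and, e2, i2, hv5, ha5]
      split_ifs with h
      · rw [h]
      · exact i6 i (by omega)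
  obtain ⟨s5, t5, h5, ht5, i1, i2, i3, i4, i5, i6⟩ := exec_loop (i := 1) (T := T w.length + 3)
    Inv₁ _ (fun k s hk => hk.1) hbody₁ s4 ⟨by simp [hs4, hv1], by simp [hs4], by simp [hs4],
      by simp [hs4, hv1], hout1.of_eq (by simp [hs4]) (by simp [hs4]),
      fun i hi => absurd hi (Nat.not_lt_zero i)⟩
  let Inv₂ : ℕ → State → Prop := fun k s' => s'.reg 1 = (G w).length - k ∧ s'.reg 2 = k ∧
    s'.reg 3 = 1 ∧ s'.reg 4 = (G w).length ∧
    (∀ i < (G w).length, s'.arr 1 i = sym (G w) i) ∧ ∀ i < k, s'.arr 0 i = sym (G w) i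
  have hbody₂ : ∀ k < (G w).length, ∀ s', Inv₂ k s' →
      ∃ s'' t, Exec body₂ s' s'' t ∧ t ≤ 4 ∧ Inv₂ (k + 1) s'' := by
    rintro k hk s' ⟨i1, i2, i3, i4, i5, i6⟩
    refine ⟨_, _, (Exec.load 5 1 2 s').seq ((Exec.store 0 2 5 _).seq ((Exec.add 2 2 3 _).seq
      (Exec.sub 1 1 3 _))), le_rfl, ?_⟩
    refine ⟨?_, ?_, ?_, ?_, fun i hi => ?_, fun i hi => ?_⟩
    · simp [i1, i3]; omega
    · simp [i2, i3]
    · simp [i3]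
    · simp [i4]
    · simpa [State.setArr_arr] using i5 i hi
    · rcases Nat.lt_succ_iff_lt_or_eq.1 hi with h | rfl
      · simpa [State.setArr_arr, i2, h.ne] using i6 i h
      · simpa [State.setArr_arr, i2] using i5 i hk
  obtain ⟨s6, t6, h6, ht6, j1, j2, j3, j4, j5, j6⟩ := exec_loop (i := 1) (T := 4)
    Inv₂ _ (fun k s hk => hk.1) hbody₂ ((s5.setReg 1 (s5.reg 4)).setReg 2 0)
    ⟨by simp [i4], by simp, by simp [i3], by simp [i4], by simpa using i6,
      fun i hi => absurd hi (Nat.not_lt_zero i)⟩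
  refine ⟨_, _, h1.seq ((Exec.copy 4 1 s1).seq ((Exec.const 2 0 _).seq ((Exec.const 3 1 _).seq
    (h5.seq ((Exec.copy 1 4 s5).seq ((Exec.const 2 0 _).seq (h6.seq (Exec.copy 0 4 s6)))))))),
    ?_, ?_, ?_⟩
  · have k1 := Nat.mul_le_mul_right (T w.length + 3 + 1) hlen
    have k2 := Nat.mul_le_mul_right (4 + 1) hlen
    have := hc w () _ hB
    simp only at this
    omega
  · simp [j4]
  · intro i x hi
    have hi' : i < (G w).length := by
      by_contra h
      rw [List.getElem?_eq_none (by omega)] at hi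
      exact absurd hi (by simp)
    rw [State.setReg_arr, j6 i hi']
    simp [sym, hi]

/-- A run of `t` steps fills at most `t` cells of an array. -/
theorem Exec.support {p : Prog} {s s' : State} {t : ℕ} (h : Exec p s s' t) (S : Finset ℕ)
    (hS : ∀ i, i ∉ S → s.arr 0 i = 0) :
    ∃ S' : Finset ℕ, S'.card ≤ S.card + t ∧ ∀ i, i ∉ S' → s'.arr 0 i = 0 := by
  induction h generalizing S with
  | store a i j s =>
    refine ⟨insert (s.reg i) S, by simpa using Finset.card_insert_le _ _, fun k hk => ?_⟩
    simp only [Finset.mem_insert, not_or] at hk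
    simp [State.setArr_arr, hk.1, hS k hk.2]
  | seq hp hq ihp ihq =>
    obtain ⟨S1, h1, h1'⟩ := ihp S hS
    obtain ⟨S2, h2, h2'⟩ := ihq S1 h1'
    exact ⟨S2, by omega, h2'⟩
  | branch_true hi hp ih =>
    obtain ⟨S1, h1, h1'⟩ := ih S hS
    exact ⟨S1, by omega, h1'⟩
  | branch_false hi hp ih =>
    obtain ⟨S1, h1, h1'⟩ := ih S hS
    exact ⟨S1, by omega, h1'⟩
  | loop_step hi hp hl ihp ihl =>
    obtain ⟨S1, h1, h1'⟩ := ihp S hS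
    obtain ⟨S2, h2, h2'⟩ := ihl S1 h1'
    exact ⟨S2, by omega, h2'⟩
  | _ => exact ⟨S, by omega, by simpa using hS⟩

/-- Both bits are stored as nonzero numbers, so every output position is a filled cell. This bounds
the size of the intermediate instance when reductions are composed. -/
theorem Exec.length_output_le {p : Prog} {w v : List Bool} {s : State} {t : ℕ}
    (h : Exec p (inputState w) s t) (hs : s.HasOutput v) : v.length ≤ w.length + t := by
  obtain ⟨S, hS, hS'⟩ := h.support (Finset.range w.length) fun i hi => by
    simp only [Finset.mem_range, not_lt] at hi
    simp [inputState, hi]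
  rw [Finset.card_range] at hS
  refine le_trans ?_ hS
  rw [← Finset.card_range v.length]
  refine Finset.card_le_card fun i hi => ?_
  rw [Finset.mem_range] at hi
  by_contra h
  have h1 := hs.2 i v[i] (by simp [hi])
  rw [hS' i h] at h1
  omega

/-- Composition with a polynomial-time reduction. -/
theorem FPTReduces.trans_polyList {A B C : ParamProblem} (h : FPTReduces A B)
    (R : B.Inst → C.Inst) {G : List Bool → List Bool} (hG : PolyList G)
    (hGR : ∀ y, G (B.encode y) = C.encode (R y)) (hyes : ∀ y, B.Yes y ↔ C.Yes (R y)) (k : ℕ)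
    (hparam : ∀ y, C.param (R y) ≤ B.param y + k) : FPTReduces A C := by
  obtain ⟨R', M, f, g, c, hf, hg, h1, h2, h3⟩ := h
  obtain ⟨M', c', hM'⟩ := hG.exists_program
  refine ⟨fun x => R (R' x), .seq M M', fun n => f n + (f n + 2) ^ c', fun n => g n + k,
    c + (c + 1) * c', ?_, ?_, fun x => (h1 x).trans (hyes _), fun x => ?_, fun x => ?_⟩
  · have hpow : Primrec fun n : ℕ => n + (n + 2) ^ c' := by
      have hp : ∀ e : ℕ, Primrec fun n : ℕ => (n + 2) ^ e := by
        intro e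
        induction e with
        | zero => simpa using Primrec.const 1
        | succ e ih =>
          simp only [pow_succ]
          exact Primrec.nat_mul.comp ih (Primrec.nat_add.comp .id (.const 2))
      exact Primrec.nat_add.comp .id (hp c')
    exact hpow.to_comp.comp hf
  · exact (Primrec.nat_add.comp .id (.const k) : Primrec fun n : ℕ => n + k).to_comp.comp hg
  · exact (hparam _).trans (Nat.add_le_add_right (h2 x) k)
  · obtain ⟨s, t, he, ho, ht⟩ := h3 x
    obtain ⟨s', t', he', ht', ho'⟩ := hM' _ s ho
    refine ⟨s', t + t', he.seq he', by rwa [hGR] at ho', ?_⟩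
    have hl := he.length_output_le ho
    set n := (A.encode x).length
    set F := f (A.param x)
    have hn : 1 ≤ (n + 1) ^ c := Nat.one_le_pow _ _ (by omega)
    -- The intermediate length splits into a factor depending on the parameter and a polynomial in
    -- `n`; a power of such a product splits again.
    have e1 : (B.encode (R' x)).length + 2 ≤ (F + 2) * (n + 1) ^ (c + 1) := by
      rw [pow_succ]; nlinarith
    have e2 : t' ≤ (F + 2) ^ c' * (n + 1) ^ ((c + 1) * c') := by
      rw [pow_mul, ← mul_pow]
      exact ht'.trans (Nat.pow_le_pow_left e1 _)
    rw [add_mul]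
    refine Nat.add_le_add (ht.trans ?_) (e2.trans ?_)
    · exact Nat.mul_le_mul_left _ (Nat.pow_le_pow_right (by omega) (by omega))
    · exact Nat.mul_le_mul_left _ (Nat.pow_le_pow_right (by omega) (by omega))

section

/-! ### The milling graph of a set system

The sets `T ℓ` for `ℓ < L`, each a set of elements `j < U`, become straight closed trails through
the hub `0`. With `C = L * U`, the cell `c = j * L + ℓ` consists of the vertices `c + 2` and
`C + 3 + c`, between which the trail of `ℓ` visits the element vertex `2 * C + 5 + j` if `j ∈ T ℓ`
and the idle vertex `2 * C + 4` otherwise. One more straight trail runs through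
`0, 1, ..., 2 * C + 4`. -/

/-- The vertex between the two vertices of the cell `c`. -/
def cellTarget (L C : ℕ) (T : ℕ → ℕ → Bool) (c : ℕ) : ℕ :=
  if T (c % L) (c / L) = true then 2 * C + 5 + c / L else 2 * C + 4

/-- The neighbour of a cell vertex that belongs to its trail and is not the hub. -/
def target (L C : ℕ) (T : ℕ → ℕ → Bool) (v : ℕ) : ℕ :=
  if 2 ≤ v ∧ v ≤ C + 1 then cellTarget L C T (v - 2)
  else if C + 3 ≤ v ∧ v ≤ 2 * C + 2 then cellTarget L C T (v - (C + 3)) else 0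

/-- Adjacency, oriented. -/
def Arc (L C : ℕ) (T : ℕ → ℕ → Bool) (u v : ℕ) : Prop :=
  1 ≤ u ∧ u ≤ 2 * C + 3 ∧ (v = 0 ∨ v = target L C T u ∨ v = u + 1)

/-- Adjacency. -/
def Link (L C : ℕ) (T : ℕ → ℕ → Bool) (u v : ℕ) : Prop := Arc L C T u v ∨ Arc L C T v u

/-- Free passage from `u` to `v` at `x`, in one direction. -/
def Through (L C : ℕ) (T : ℕ → ℕ → Bool) (x u v : ℕ) : Prop :=
  if x = 0 then v = u + (C + 1 - L) ∧ L + 2 ≤ u ∧ u ≤ C + 1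
  else if x ≤ 2 * C + 3 then (u + 1 = x ∧ v = x + 1) ∨ (u = 0 ∧ v = target L C T x ∧ v ≠ 0)
  else v = u + (C + 1) ∧ 2 ≤ u ∧ u ≤ C + 1

instance (L C : ℕ) (T : ℕ → ℕ → Bool) (u v : ℕ) : Decidable (Link L C T u v) := by
  unfold Link Arc; infer_instance

instance (L C : ℕ) (T : ℕ → ℕ → Bool) (x u v : ℕ) : Decidable (Through L C T x u v) := by
  unfold Through; infer_instance

/-- The turn costs. -/
def cost (L C : ℕ) (T : ℕ → ℕ → Bool) : TurnCost ℕ := fun x u v =>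
  decide (¬ (Through L C T x u v ∨ Through L C T x v u))

variable {L C : ℕ} {T : ℕ → ℕ → Bool}

theorem cost_eq_false {x u v : ℕ} :
    cost L C T x u v = false ↔ Through L C T x u v ∨ Through L C T x v u := by
  simp only [cost, decide_eq_false_iff_not, not_not]

theorem Link.symm {u v : ℕ} (h : Link L C T u v) : Link L C T v u := Or.symm h

theorem le_cellTarget (c : ℕ) : 2 * C + 4 ≤ cellTarget L C T c := by
  have := Nat.zero_le (c / L)
  unfold cellTarget; split_ifs <;> omega

theorem target_left {c : ℕ} (hc : c < C) : target L C T (c + 2) = cellTarget L C T c := by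
  unfold target; rw [if_pos (by omega)]; simp

theorem target_right {c : ℕ} (hc : c < C) : target L C T (C + 3 + c) = cellTarget L C T c := by
  unfold target; rw [if_neg (by omega), if_pos (by omega)]; simp

/-- This keeps the kinds of edges apart: a nonzero target lies beyond the spine vertices `1, ..., 2
* C + 3` and belongs to a cell vertex, so `target` never yields a spine edge. -/
theorem target_eq_zero_or (v : ℕ) : target L C T v = 0 ∨ 2 * C + 4 ≤ target L C T v ∧
    2 ≤ v ∧ v ≤ 2 * C + 2 ∧ v ≠ C + 2 := by
  unfold target
  split_ifs
  · exact .inr ⟨le_cellTarget _, by omega⟩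
  · exact .inr ⟨le_cellTarget _, by omega⟩
  · exact .inl rfl

theorem not_link_self (u : ℕ) : ¬ Link L C T u u := by
  unfold Link Arc
  rcases target_eq_zero_or (L := L) (C := C) (T := T) u with h | h <;> omega

/-- At the hub, the idle vertex and the element vertices, free passages join a left cell vertex to a
right one by a shift. At a spine vertex there are two disjoint pairs. The condition `v ≠ 0` in
`Through` matters where the target is the default `0`: otherwise vertex `1` would allow both `0` and
`2` after `0`. -/
theorem cost_pairing {x u v w : ℕ} (hv : cost L C T x u v = false)
    (hw : cost L C T x u w = false) : v = w := by
  rw [cost_eq_false] at hv hw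
  unfold Through at hv hw
  rcases target_eq_zero_or (L := L) (C := C) (T := T) x with h | h <;> split_ifs at hv hw <;> omega

theorem cost_symm {x u v : ℕ} (h : cost L C T x u v = false) : cost L C T x v u = false := by
  rw [cost_eq_false] at h ⊢; exact h.symm

/-- The milling graph. -/
def millGraph (L U : ℕ) (T : ℕ → ℕ → Bool) : SimpleGraph (Fin (2 * (L * U) + 5 + U)) where
  Adj u v := Link L (L * U) T u v
  symm := ⟨fun _ _ h => h.symm⟩
  loopless := ⟨fun u => not_link_self u.val⟩

/-- The turn costs of the milling graph. -/
def millCost (L U : ℕ) (T : ℕ → ℕ → Bool) : TurnCost (Fin (2 * (L * U) + 5 + U)) :=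
  fun x u v => cost L (L * U) T x u v

theorem millCost_isPairing (L U : ℕ) (T : ℕ → ℕ → Bool) :
    IsPairing (millGraph L U T) (millCost L U T) :=
  fun _ _ _ _ _ _ _ hv hw => Fin.ext (cost_pairing hv hw)

theorem millCost_isSymmetric (L U : ℕ) (T : ℕ → ℕ → Bool) :
    IsSymmetric (millGraph L U T) (millCost L U T) :=
  fun _ _ _ _ _ h => cost_symm h

/-! #### Pathwidth -/

/-- The vertices of the bag `i`. -/
def bagList (L C i : ℕ) : List ℕ :=
  [0, 1, C + 2, 2 * C + 3, 2 * C + 4, i + 2, i + 3, C + 3 + i, C + 4 + i, 2 * C + 5 + i / L]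

theorem cell_cases {v : ℕ} (h1 : 1 ≤ v) (h2 : v ≤ 2 * C + 3) :
    (v = 1 ∨ v = C + 2 ∨ v = 2 * C + 3) ∨ ∃ c < C, v = c + 2 ∨ v = C + 3 + c := by
  by_cases h : v = 1 ∨ v = C + 2 ∨ v = 2 * C + 3
  · exact .inl h
  · right
    by_cases h' : v ≤ C + 1
    · exact ⟨v - 2, by omega, by omega⟩
    · exact ⟨v - (C + 3), by omega, by omega⟩

theorem exists_bag_of_arc (hC : 0 < C) {u v : ℕ} (h : Arc L C T u v) :
    ∃ i < C, u ∈ bagList L C i ∧ v ∈ bagList L C i := by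
  obtain ⟨h1, h2, h3⟩ := h
  rcases cell_cases h1 h2 with h | ⟨c, hc, h⟩
  · have ht : target L C T u = 0 := by
      rcases target_eq_zero_or (L := L) (C := C) (T := T) u with h' | h'
      · exact h'
      · omega
    rw [ht] at h3
    -- The successors `2` of `1` and `C + 3` of `C + 2` are in bag `0`; `2 * C + 3` and its
    -- successor are in every bag.
    refine ⟨if u = C + 2 then 0 else if u = 1 then 0 else C - 1, by split_ifs <;> omega, ?_⟩
    simp only [bagList, List.mem_cons, List.not_mem_nil, or_false]
    split_ifs <;> omega
  · have ht : target L C T u = cellTarget L C T c := by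
      rcases h with rfl | rfl
      · exact target_left hc
      · exact target_right hc
    have ht' : cellTarget L C T c = 2 * C + 4 ∨ cellTarget L C T c = 2 * C + 5 + c / L := by
      unfold cellTarget; split_ifs <;> simp
    refine ⟨c, hc, ?_⟩
    rw [ht] at h3
    simp only [bagList, List.mem_cons, List.not_mem_nil, or_false]
    omega

/-- Five entries are constant, four move along the spine by one per bag, and the element entry is
monotone since the cells of one element are consecutive. The bound on `k` keeps the left and right
windows from meeting except at constant entries. -/
theorem bag_interval {i j k v : ℕ} (hij : i ≤ j) (hjk : j ≤ k) (hk : k = 0 ∨ k < C)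
    (hi : v ∈ bagList L C i) (hk' : v ∈ bagList L C k) : v ∈ bagList L C j := by
  have h1 : i / L ≤ j / L := Nat.div_le_div_right hij
  have h2 : j / L ≤ k / L := Nat.div_le_div_right hjk
  simp only [bagList, List.mem_cons, List.not_mem_nil, or_false] at *
  generalize i / L = a at *
  generalize j / L = b at *
  generalize k / L = c at *
  omega

/-- The path decomposition of the milling graph. -/
def millDecomposition (U : ℕ) (T : ℕ → ℕ → Bool) (hL : 0 < L) :
    PathDecomposition (millGraph L U T) where
  m := L * U - 1
  bag i := Finset.univ.filter fun v => v.val ∈ bagList L (L * U) i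
  vertex_mem v := by
    have hv := v.2
    have key : ∃ i < L * U - 1 + 1, v.val ∈ bagList L (L * U) i := by
      generalize v.val = v at hv
      by_cases h1 : v ≤ 2 * (L * U) + 4
      · by_cases h0 : v = 0 ∨ v = 2 * (L * U) + 4
        · exact ⟨0, by omega, by rcases h0 with rfl | rfl <;> simp [bagList]⟩
        · rcases cell_cases (C := L * U) (v := v) (by omega) (by omega) with h | ⟨c, hc, h⟩
          · refine ⟨0, by omega, ?_⟩
            rcases h with rfl | rfl | rfl <;> simp [bagList]
          · refine ⟨c, by omega, ?_⟩
            rcases h with rfl | rfl <;> simp [bagList]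
      · obtain ⟨j, rfl⟩ : ∃ j, v = 2 * (L * U) + 5 + j := ⟨v - (2 * (L * U) + 5), by omega⟩
        have hj : j < U := by omega
        have : L * j < L * U := Nat.mul_lt_mul_of_pos_left hj hL
        exact ⟨L * j, by omega, by simp [bagList, hL]⟩
    obtain ⟨i, hi, h⟩ := key
    exact ⟨⟨i, hi⟩, by simpa using h⟩
  edge_mem u v h := by
    -- Without elements there are no cells, and the only bag contains all five vertices.
    rcases Nat.eq_zero_or_pos U with rfl | hU
    · have key : ∀ u : Fin (2 * (L * 0) + 5 + 0), u.val ∈ bagList L (L * 0) 0 := fun u => by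
        have hu := u.2
        simp only [bagList, List.mem_cons, List.not_mem_nil, or_false]
        omega
      exact ⟨⟨0, by omega⟩, by simpa using key u, by simpa using key v⟩
    have hC : 0 < L * U := Nat.mul_pos hL hU
    rcases h with h | h
    · obtain ⟨i, hi, h1, h2⟩ := exists_bag_of_arc hC h
      exact ⟨⟨i, by omega⟩, by simpa using h1, by simpa using h2⟩
    · obtain ⟨i, hi, h1, h2⟩ := exists_bag_of_arc hC h
      exact ⟨⟨i, by omega⟩, by simpa using h2, by simpa using h1⟩
  interval v i j k hij hjk hi hk := by
    simp only [Finset.mem_filter, Finset.mem_univ, true_and] at *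
    exact bag_interval hij hjk (by have := k.2; omega) hi hk

theorem pathwidth_millGraph_le (U : ℕ) (T : ℕ → ℕ → Bool) (hL : 0 < L) :
    pathwidth (millGraph L U T) ≤ 9 := by
  refine Nat.sInf_le ⟨millDecomposition U T hL, fun i => ?_⟩
  calc ((millDecomposition U T hL).bag i).card
      ≤ (bagList L (L * U) i).toFinset.card :=
        Finset.card_le_card_of_injOn Fin.val (fun v hv => by
          simpa [millDecomposition] using hv) (Fin.val_injective.injOn)
    _ ≤ (bagList L (L * U) i).length := List.toFinset_card_le _
    _ = 9 + 1 := rfl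

/-! #### A cover by few sets gives a covering walk -/

/-- A walk with at most `B` turns. -/
def Cheap (L C : ℕ) (T : ℕ → ℕ → Bool) (l : List ℕ) (B : ℕ) : Prop :=
  l.IsChain (Link L C T) ∧ turnCost (cost L C T) l ≤ B

theorem Cheap.cons_turn {u x : ℕ} {l : List ℕ} {B : ℕ} (h : Cheap L C T (x :: l) B)
    (hu : Link L C T u x) : Cheap L C T (u :: x :: l) (B + 1) := by
  refine ⟨List.isChain_cons_cons.2 ⟨hu, h.1⟩, ?_⟩
  cases l with
  | nil => simp [turnCost]
  | cons v l =>
    have h1 := h.2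
    have h2 := Bool.toNat_le (cost L C T x u v)
    simp only [turnCost] at *
    omega

theorem Cheap.cons {u x v : ℕ} {l : List ℕ} {B : ℕ} (h : Cheap L C T (x :: v :: l) B)
    (hu : Link L C T u x) (hx : Through L C T x u v ∨ Through L C T x v u) :
    Cheap L C T (u :: x :: v :: l) B :=
  ⟨List.isChain_cons_cons.2 ⟨hu, h.1⟩, by
    simpa [turnCost, cost_eq_false.2 hx] using h.2⟩

theorem Cheap.mono {l : List ℕ} {B B' : ℕ} (h : Cheap L C T l B) (hB : B ≤ B') :
    Cheap L C T l B' := ⟨h.1, h.2.trans hB⟩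

/-- The part of a trail that belongs to the cell `c`, with the return to the hub. -/
def cellTrail (L C : ℕ) (T : ℕ → ℕ → Bool) (c : ℕ) : List ℕ :=
  [c + 2, cellTarget L C T c, C + 3 + c, 0]

theorem cheap_cellTrail {c : ℕ} (hc : c < C) {r : List ℕ} {B : ℕ}
    (h : Cheap L C T ((C + 3 + c) :: 0 :: r) B) :
    Cheap L C T (0 :: (cellTrail L C T c ++ r)) B := by
  have h1 := le_cellTarget (L := L) (C := C) (T := T) c
  have l1 : Link L C T (c + 2) (cellTarget L C T c) :=
    .inl ⟨by omega, by omega, .inr (.inl (target_left hc).symm)⟩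
  have l2 : Link L C T (cellTarget L C T c) (C + 3 + c) :=
    .inr ⟨by omega, by omega, .inr (.inl (target_right hc).symm)⟩
  have l0 : Link L C T 0 (c + 2) := .inr ⟨by omega, by omega, .inl rfl⟩
  refine Cheap.cons (Cheap.cons (Cheap.cons h l2 ?_) l1 ?_) l0 ?_
  · right
    unfold Through
    rw [if_neg (by omega), if_pos (by omega), target_right hc]
    omega
  · left
    unfold Through
    rw [if_neg (by omega), if_neg (by omega)]
    omega
  · left
    unfold Through
    rw [if_neg (by omega), if_pos (by omega), target_left hc]
    omega

/-- The cells of the set `ℓ` from row `j` on, `n` of them. -/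
def trailFrom (L C : ℕ) (T : ℕ → ℕ → Bool) (ℓ j n : ℕ) : List ℕ :=
  (List.range' j n).flatMap fun i => cellTrail L C T (i * L + ℓ)

theorem cell_lt {U ℓ j : ℕ} (hℓ : ℓ < L) (hj : j < U) : j * L + ℓ < L * U := by
  have : (j + 1) * L ≤ U * L := Nat.mul_le_mul_right L hj
  rw [Nat.succ_mul] at this
  rw [mul_comm L U]; omega

/-- At the hub the right vertex of a cell continues freely to the left vertex of the cell `L`
further, which is the next row of the same set. The rest `r` is required to be cheap after any
predecessor `p` of the hub, since the turn that starts the next trail is charged to `r` whatever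
comes before. -/
theorem cheap_trailFrom {U ℓ : ℕ} (hℓ : ℓ < L) {r : List ℕ} {B : ℕ}
    (hr : ∀ p, Link L (L * U) T p 0 → Cheap L (L * U) T (p :: 0 :: r) B) (n j : ℕ)
    (hn : j + 1 + n = U) :
    Cheap L (L * U) T
      ((L * U + 3 + (j * L + ℓ)) :: 0 :: (trailFrom L (L * U) T ℓ (j + 1) n ++ r)) B := by
  have hjc : j * L + ℓ < L * U := cell_lt hℓ (by omega)
  have hl : Link L (L * U) T (L * U + 3 + (j * L + ℓ)) 0 := .inl ⟨by omega, by omega, .inl rfl⟩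
  induction n generalizing j with
  | zero => exact hr _ hl
  | succ n ih =>
    have hc : (j + 1) * L + ℓ < L * U := cell_lt hℓ (by omega)
    have h1 := ih (j + 1) (by omega) hc (.inl ⟨by omega, by omega, .inl rfl⟩)
    have h2 := cheap_cellTrail hc h1
    simp only [trailFrom, List.range'_succ, List.flatMap_cons, List.append_assoc]
    refine Cheap.cons h2 hl (.inr ?_)
    have hs : (j + 1) * L = j * L + L := Nat.succ_mul j L
    unfold Through
    rw [if_pos rfl]
    omega

/-- The only turn is at the hub, before the first cell. -/
theorem cheap_trail {U ℓ : ℕ} (hℓ : ℓ < L) {r : List ℕ} {B : ℕ}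
    (hr : ∀ p, Link L (L * U) T p 0 → Cheap L (L * U) T (p :: 0 :: r) B) (p : ℕ)
    (hp : Link L (L * U) T p 0) :
    Cheap L (L * U) T (p :: 0 :: (trailFrom L (L * U) T ℓ 0 U ++ r)) (B + 1) := by
  rcases U with - | U
  · exact (hr p hp).mono (by omega)
  · have hc : 0 * L + ℓ < L * (U + 1) := cell_lt hℓ (by omega)
    have h1 := cheap_trailFrom hℓ hr U 0 (by omega)
    have h2 := cheap_cellTrail hc h1
    have h3 := h2.cons_turn hp
    simpa only [trailFrom, List.range'_succ, List.flatMap_cons, List.append_assoc] using h3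

theorem cheap_trails {U : ℕ} (S : List ℕ) (hS : ∀ ℓ ∈ S, ℓ < L) (p : ℕ)
    (hp : Link L (L * U) T p 0) :
    Cheap L (L * U) T (p :: 0 :: S.flatMap fun ℓ => trailFrom L (L * U) T ℓ 0 U) S.length := by
  induction S generalizing p with
  | nil => exact ⟨by simp [hp], by simp [turnCost]⟩
  | cons ℓ S ih =>
    rw [List.flatMap_cons]
    exact cheap_trail (hS ℓ (by simp))
      (fun p hp => ih (fun ℓ h => hS ℓ (by simp [h])) p hp) p hp

/-- The covering walk begins at the far end of the spine and descends to the hub without a turn;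
this visits everything but the element vertices. -/
theorem cheap_sweep {r : List ℕ} {B : ℕ} (h : Cheap L C T (1 :: 0 :: r) B) (n : ℕ)
    (hn : n ≤ 2 * C + 3) : Cheap L C T ((List.range (n + 2)).reverse ++ r) B := by
  induction n with
  | zero => exact h
  | succ n ih =>
    have h1 := ih (by omega)
    rw [List.range_succ, List.reverse_append]
    rw [List.range_succ, List.reverse_append, List.range_succ, List.reverse_append] at h1 ⊢
    simp only [List.reverse_singleton, List.cons_append] at h1 ⊢
    refine h1.cons (.inr ⟨by omega, by omega, by omega⟩) (.inr ?_)
    unfold Through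
    rw [if_neg (by omega), if_pos (by omega)]
    omega

theorem turnCost_map {V W : Type} (g : V → W) (f : TurnCost V) (f' : TurnCost W)
    (h : ∀ x u v, f x u v = f' (g x) (g u) (g v)) (l : List V) :
    turnCost f l = turnCost f' (l.map g) := by
  fun_induction turnCost f l with
  | case1 u x v l ih => simp only [List.map_cons, turnCost] at *; rw [ih, h]
  | case2 l hl =>
    rcases l with - | ⟨a, - | ⟨b, - | ⟨c, l⟩⟩⟩
    · rfl
    · rfl
    · rfl
    · exact absurd rfl (hl a b c l)

theorem hasCoveringWalk_of_cover {U r : ℕ} {S : Finset ℕ} (hS : S.card ≤ r)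
    (hlt : ∀ ℓ ∈ S, ℓ < L) (hcov : ∀ j < U, ∃ ℓ ∈ S, T ℓ j = true) :
    HasCoveringWalk (millGraph L U T) (millCost L U T) r := by
  have hl0 : Link L (L * U) T 1 0 := .inl ⟨le_rfl, by omega, .inl rfl⟩
  obtain ⟨hch, htc⟩ := cheap_sweep (cheap_trails (U := U) (T := T) S.toList (by simpa using hlt)
    1 hl0) (2 * (L * U) + 3) le_rfl
  set l := (List.range (2 * (L * U) + 3 + 2)).reverse ++
    S.toList.flatMap fun ℓ => trailFrom L (L * U) T ℓ 0 U with hl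
  have hlN : ∀ x ∈ l, x < 2 * (L * U) + 5 + U := by
    intro x hx
    rw [hl, List.mem_append, List.mem_reverse, List.mem_range, List.mem_flatMap] at hx
    rcases hx with hx | ⟨ℓ, hℓ, hx⟩
    · omega
    · simp only [trailFrom, List.mem_flatMap, List.mem_range'_1] at hx
      obtain ⟨j, hj, hx⟩ := hx
      have hℓ' := hlt ℓ (by simpa using hℓ)
      have hc : j * L + ℓ < L * U := cell_lt hℓ' (by omega)
      have hd : (j * L + ℓ) / L = j := by
        rw [mul_comm, Nat.mul_add_div (by omega), Nat.div_eq_of_lt hℓ', add_zero]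
      simp only [cellTrail, cellTarget, hd, List.mem_cons, List.not_mem_nil, or_false] at hx
      split_ifs at hx <;> omega
  have hcover : ∀ x < 2 * (L * U) + 5 + U, x ∈ l := by
    intro x hx
    rw [hl, List.mem_append, List.mem_reverse, List.mem_range, List.mem_flatMap]
    by_cases h : x < 2 * (L * U) + 3 + 2
    · exact .inl h
    · obtain ⟨j, rfl⟩ : ∃ j, x = 2 * (L * U) + 5 + j := ⟨x - (2 * (L * U) + 5), by omega⟩
      obtain ⟨ℓ, hℓ, hT⟩ := hcov j (by omega)
      refine .inr ⟨ℓ, by simpa using hℓ, ?_⟩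
      simp only [trailFrom, List.mem_flatMap, List.mem_range'_1]
      refine ⟨j, by omega, ?_⟩
      have hℓ' := hlt ℓ hℓ
      have hd : (j * L + ℓ) / L = j := by
        rw [mul_comm, Nat.mul_add_div (by omega), Nat.div_eq_of_lt hℓ', add_zero]
      have hm : (j * L + ℓ) % L = ℓ := by
        rw [mul_comm, Nat.mul_add_mod, Nat.mod_eq_of_lt hℓ']
      simp [cellTrail, cellTarget, hd, hm, hT]
  obtain ⟨l', hl'⟩ : ∃ l' : List (Fin (2 * (L * U) + 5 + U)), l'.map Fin.val = l :=
    ⟨l.pmap Fin.mk hlN, by simp [List.map_pmap]⟩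
  have hch' : l'.IsChain (millGraph L U T).Adj := by
    rw [← hl', List.isChain_map] at hch
    exact hch
  have hne : l' ≠ [] := by
    rintro rfl
    have := hcover 0 (by omega)
    rw [← hl'] at this
    simp at this
  refine ⟨_, _, SimpleGraph.Walk.ofSupport l' hne hch', fun x => ?_, ?_⟩
  · rw [SimpleGraph.Walk.support_ofSupport]
    have := hcover x.val x.2
    rw [← hl', List.mem_map] at this
    obtain ⟨y, hy, hxy⟩ := this
    rwa [← Fin.ext hxy]
  · rw [SimpleGraph.Walk.support_ofSupport, turnCost_map Fin.val (millCost L U T)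
      (cost L (L * U) T) (fun _ _ _ => rfl), hl']
    exact htc.trans (by simpa using hS)

/-! #### A covering walk gives a cover by few sets -/

/-- The trail that contains the edge from the hub to `v`. -/
def vertexLabel (L C v : ℕ) : ℕ :=
  if 2 ≤ v ∧ v ≤ C + 1 then (v - 2) % L + 1
  else if C + 3 ≤ v ∧ v ≤ 2 * C + 2 then (v - (C + 3)) % L + 1 else 0

/-- The trail that contains the edge `uv`. -/
def edgeLabel (L C u v : ℕ) : ℕ :=
  if 1 ≤ u ∧ u ≤ 2 * C + 3 then if 1 ≤ v ∧ v ≤ 2 * C + 3 then 0 else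
    if v = u + 1 then 0 else vertexLabel L C u
  else if u = v + 1 ∧ v ≠ 0 then 0 else vertexLabel L C v

theorem edgeLabel_symm {u v : ℕ} (h : Link L C T u v) : edgeLabel L C u v = edgeLabel L C v u := by
  have h0 : ∀ v, v = 0 ∨ 2 * C + 4 ≤ v → vertexLabel L C v = 0 := by
    intro v hv
    unfold vertexLabel
    rw [if_neg (by omega), if_neg (by omega)]
  unfold edgeLabel
  rcases h with ⟨h1, h2, h3⟩ | ⟨h1, h2, h3⟩ <;> split_ifs <;> first | rfl | omega

/-- The trails partition the edges, and free passages never leave a trail. This is what makes the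
number of turns control the number of trails. -/
theorem edgeLabel_eq_of_through {x u v : ℕ} (hu : Link L C T x u) (hv : Link L C T x v)
    (h : Through L C T x u v) : edgeLabel L C u x = edgeLabel L C x v := by
  unfold Through at h
  split_ifs at h with h1 h2
  · subst h1
    obtain ⟨rfl, h1, h2⟩ := h
    -- The two cells are `L` apart, hence belong to the same set.
    have hm : (u - 2) % L = (u + (C + 1 - L) - (C + 3)) % L := by
      by_cases hL : C + 1 ≤ L
      · omega
      · have : u - 2 = (u + (C + 1 - L) - (C + 3)) + L := by omega
        rw [this, Nat.add_mod_right]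
    unfold edgeLabel vertexLabel
    rw [if_pos (by omega), if_neg (by omega), if_neg (by omega), if_pos (by omega),
      if_neg (by omega), if_neg (by omega), if_neg (by omega), if_pos (by omega), hm]
  · have ht := target_eq_zero_or (L := L) (C := C) (T := T) x
    unfold edgeLabel vertexLabel
    rcases h with h | h <;> split_ifs <;> first | rfl | omega
  · obtain ⟨rfl, h3, h4⟩ := h
    have hm : u - 2 = u + (C + 1) - (C + 3) := by omega
    unfold edgeLabel vertexLabel
    split_ifs <;> first | rfl | omega | rw [hm]

theorem edgeLabel_eq_of_cost {x u v : ℕ} (hu : Link L C T u x) (hv : Link L C T x v)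
    (h : cost L C T x u v = false) : edgeLabel L C u x = edgeLabel L C x v := by
  rcases cost_eq_false.1 h with h | h
  · exact edgeLabel_eq_of_through hu.symm hv h
  · rw [edgeLabel_symm hu, edgeLabel_symm hv, edgeLabel_eq_of_through hv hu.symm h]

/-- The labels of the edges of a walk. -/
def edgeLabels (L C : ℕ) (l : List ℕ) : List ℕ := List.zipWith (edgeLabel L C) l l.tail

/-- A new label can appear only where a turn is paid; the `+ 1` is for the first edge. -/
theorem card_edgeLabels_le (l : List ℕ) (hl : l.IsChain (Link L C T)) :
    (edgeLabels L C l).toFinset.card ≤ turnCost (cost L C T) l + 1 := by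
  fun_induction turnCost (cost L C T) l with
  | case1 u x v l ih =>
    rw [List.isChain_cons_cons] at hl
    have h1 := ih hl.2
    have hxv := (List.isChain_cons_cons.1 hl.2).1
    have he : edgeLabels L C (u :: x :: v :: l) =
      edgeLabel L C u x :: edgeLabels L C (x :: v :: l) := rfl
    have he' : edgeLabels L C (x :: v :: l) = edgeLabel L C x v :: edgeLabels L C (v :: l) := rfl
    rw [he, List.toFinset_cons]
    cases hc : cost L C T x u v with
    | false =>
      rw [Finset.insert_eq_of_mem]
      · simpa using h1
      · rw [edgeLabel_eq_of_cost hl.1 hxv hc, he']; simp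
    | true =>
      have := Finset.card_insert_le (edgeLabel L C u x) (edgeLabels L C (x :: v :: l)).toFinset
      simp only [Bool.toNat_true]
      omega
  | case2 l h =>
    rcases l with - | ⟨a, - | ⟨b, - | ⟨c, l⟩⟩⟩
    · simp [edgeLabels]
    · simp [edgeLabels]
    · simp [edgeLabels]
    · exact absurd rfl (h a b c l)

theorem exists_edgeLabel_mem (l : List ℕ) (hl : l.IsChain (Link L C T)) (h2 : 2 ≤ l.length)
    {x : ℕ} (hx : x ∈ l) : ∃ y, Link L C T x y ∧ edgeLabel L C x y ∈ edgeLabels L C l := by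
  induction l with
  | nil => simp at hx
  | cons u l ih =>
    rcases l with - | ⟨v, l⟩
    · simp at h2
    · have huv := (List.isChain_cons_cons.1 hl).1
      have he : edgeLabels L C (u :: v :: l) = edgeLabel L C u v :: edgeLabels L C (v :: l) := rfl
      rw [he]
      rcases List.mem_cons.1 hx with rfl | hx
      · exact ⟨v, huv, by simp⟩
      · rcases l with - | ⟨w, l⟩
        · obtain rfl : x = v := by simpa using hx
          exact ⟨u, huv.symm, by rw [edgeLabel_symm huv.symm]; simp⟩
        · obtain ⟨y, hy, hm⟩ := ih (List.isChain_cons_cons.1 hl).2 (by simp) hx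
          exact ⟨y, hy, by simp [hm]⟩

/-- Vertex `1` lies in no cell, so a covering walk must use the spine label; this label accounts for
the `+ 1` in `card_edgeLabels_le`. -/
theorem edgeLabel_one (y : ℕ) : edgeLabel L C 1 y = 0 := by
  unfold edgeLabel vertexLabel
  split_ifs <;> first | rfl | omega

/-- An element vertex is adjacent only to cell vertices that have it as target, that is, to cells in
row `j` of sets containing `j`. -/
theorem edgeLabel_element (hL : 0 < L) {j y : ℕ} (h : Link L C T (2 * C + 5 + j) y) :
    ∃ ℓ < L, edgeLabel L C (2 * C + 5 + j) y = ℓ + 1 ∧ T ℓ j = true := by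
  rcases h with h | ⟨h1, h2, h3⟩
  · obtain ⟨h1, h2, -⟩ := h; omega
  have h4 : target L C T y = 2 * C + 5 + j := by omega
  have key : ∀ c, cellTarget L C T c = 2 * C + 5 + j → T (c % L) j = true := by
    intro c hc
    unfold cellTarget at hc
    split_ifs at hc with h
    · obtain rfl : c / L = j := by omega
      exact h
    · omega
  have he : edgeLabel L C (2 * C + 5 + j) y = vertexLabel L C y := by
    unfold edgeLabel
    rw [if_neg (by omega), if_neg (by omega)]
  rw [he]
  unfold target at h4
  unfold vertexLabel
  split_ifs at h4 ⊢
  · exact ⟨_, Nat.mod_lt _ hL, rfl, key _ h4⟩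
  · exact ⟨_, Nat.mod_lt _ hL, rfl, key _ h4⟩
  · omega

theorem cover_of_hasCoveringWalk {U r : ℕ} (hL : 0 < L)
    (h : HasCoveringWalk (millGraph L U T) (millCost L U T) r) :
    ∃ S : Finset ℕ, S.card ≤ r ∧ (∀ ℓ ∈ S, ℓ < L) ∧ ∀ j < U, ∃ ℓ ∈ S, T ℓ j = true := by
  obtain ⟨a, b, W, hcov, htc⟩ := h
  have hch : (W.support.map Fin.val).IsChain (Link L (L * U) T) := by
    rw [List.isChain_map]; exact W.isChain_adj_support
  rw [turnCost_map Fin.val (millCost L U T) (cost L (L * U) T) (fun _ _ _ => rfl)] at htc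
  have hmem : ∀ x < 2 * (L * U) + 5 + U, x ∈ W.support.map Fin.val := fun x hx =>
    List.mem_map.2 ⟨⟨x, hx⟩, hcov _, rfl⟩
  have hlen : 2 ≤ (W.support.map Fin.val).length := by
    have h0 := hmem 0 (by omega)
    have h1 := hmem 1 (by omega)
    rcases h : W.support.map Fin.val with - | ⟨u, - | ⟨v, l⟩⟩
    · simp [h] at h0
    · rw [h, List.mem_singleton] at h0 h1; omega
    · simp
  have hcard := card_edgeLabels_le _ hch
  set E := (edgeLabels L (L * U) (W.support.map Fin.val)).toFinset with hE
  have h0 : 0 ∈ E := by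
    obtain ⟨y, -, hm⟩ := exists_edgeLabel_mem _ hch hlen (hmem 1 (by omega))
    rw [edgeLabel_one] at hm
    simpa [hE] using hm
  refine ⟨(Finset.range L).filter fun ℓ => ℓ + 1 ∈ E, ?_, fun ℓ hℓ => ?_, fun j hj => ?_⟩
  · have : ((Finset.range L).filter fun ℓ => ℓ + 1 ∈ E).card ≤ (E.erase 0).card :=
      Finset.card_le_card_of_injOn (· + 1) (fun ℓ hℓ => by
        simpa using (Finset.mem_filter.1 hℓ).2) (fun a _ b _ h => Nat.succ_injective h)
    rw [Finset.card_erase_of_mem h0] at this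
    omega
  · exact Finset.mem_range.1 (Finset.mem_filter.1 hℓ).1
  · obtain ⟨y, hy, hm⟩ := exists_edgeLabel_mem _ hch hlen (hmem (2 * (L * U) + 5 + j) (by omega))
    obtain ⟨ℓ, hℓ, he, hT⟩ := edgeLabel_element hL hy
    rw [he] at hm
    exact ⟨ℓ, by simp [hE, hℓ, hm], hT⟩

theorem hasCoveringWalk_iff {U r : ℕ} (hL : 0 < L) :
    HasCoveringWalk (millGraph L U T) (millCost L U T) r ↔
      ∃ S : Finset ℕ, S.card ≤ r ∧ (∀ ℓ ∈ S, ℓ < L) ∧ ∀ j < U, ∃ ℓ ∈ S, T ℓ j = true :=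
  ⟨cover_of_hasCoveringWalk hL, fun ⟨_, h1, h2, h3⟩ => hasCoveringWalk_of_cover h1 h2 h3⟩

end

section

/-! ### Weighted satisfiability as a covering problem

A set `(i, a, b)` says that the `i`-th true variable is the `a`-th variable and that the next one
is the `b`-th (variables are counted from `1`; for `i = 0` there is no true variable). -/

/-- The `i`-component of a set. -/
def idx (n ℓ : ℕ) : ℕ := ℓ / (n + 2) / (n + 1)

/-- The `a`-component of a set. -/
def fst (n ℓ : ℕ) : ℕ := ℓ / (n + 2) % (n + 1)

/-- The `b`-component of a set. -/
def snd (n ℓ : ℕ) : ℕ := ℓ % (n + 2)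

/-- The set with given components. -/
def code (n i a b : ℕ) : ℕ := (i * (n + 1) + a) * (n + 2) + b

/-- The set `ℓ` covers the element `j`: the elements `g * (n + 2) + v` with `g < w` make the chosen
sets a chain, the later ones are the clauses. -/
def Covers (n w : ℕ) (Sat : ℕ → ℕ → ℕ → ℕ → Prop) (ℓ j : ℕ) : Prop :=
  if j < w * (n + 2) then
    (idx n ℓ = j / (n + 2) ∧ fst n ℓ < snd n ℓ ∧ snd n ℓ ≤ j % (n + 2)) ∨
      (idx n ℓ = j / (n + 2) + 1 ∧ j % (n + 2) < fst n ℓ)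
  else Sat (j - w * (n + 2)) (idx n ℓ) (fst n ℓ) (snd n ℓ)

/-- The set `(i, a, b)` implies a literal. -/
def Implies (i a b c : ℕ) (s : Bool) : Prop :=
  (s = true ∧ i ≠ 0 ∧ a = c + 1) ∨ (s = false ∧ a ≤ c ∧ c + 1 < b)

variable {n w : ℕ}

theorem fst_le (ℓ : ℕ) : fst n ℓ ≤ n := Nat.lt_succ_iff.1 (Nat.mod_lt _ (by omega))

theorem idx_le {ℓ : ℕ} (h : ℓ < (w + 1) * (n + 1) * (n + 2)) : idx n ℓ ≤ w := by
  refine Nat.lt_succ_iff.1 (Nat.div_lt_of_lt_mul (Nat.div_lt_of_lt_mul ?_))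
  calc ℓ < _ := h
    _ = _ := by rw [Nat.succ_eq_add_one]; ring

theorem code_lt {i a b : ℕ} (hi : i ≤ w) (ha : a ≤ n) (hb : b ≤ n + 1) :
    code n i a b < (w + 1) * (n + 1) * (n + 2) := by
  have h1 : i * (n + 1) + a + 1 ≤ (w + 1) * (n + 1) := by
    have := Nat.mul_le_mul_right (n + 1) hi
    rw [Nat.succ_mul]; omega
  have h2 := Nat.mul_le_mul_right (n + 2) h1
  rw [Nat.succ_mul] at h2
  unfold code; omega

theorem snd_code {i a b : ℕ} (hb : b ≤ n + 1) : snd n (code n i a b) = b := by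
  unfold snd code
  rw [mul_comm, Nat.mul_add_mod, Nat.mod_eq_of_lt (by omega)]

theorem code_div {i a b : ℕ} (hb : b ≤ n + 1) : code n i a b / (n + 2) = i * (n + 1) + a := by
  unfold code
  rw [mul_comm, Nat.mul_add_div (by omega), Nat.div_eq_of_lt (by omega), add_zero]

theorem fst_code {i a b : ℕ} (ha : a ≤ n) (hb : b ≤ n + 1) : fst n (code n i a b) = a := by
  unfold fst
  rw [code_div hb, mul_comm, Nat.mul_add_mod, Nat.mod_eq_of_lt (by omega)]

theorem idx_code {i a b : ℕ} (ha : a ≤ n) (hb : b ≤ n + 1) : idx n (code n i a b) = i := by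
  unfold idx
  rw [code_div hb, mul_comm, Nat.mul_add_div (by omega), Nat.div_eq_of_lt (by omega), add_zero]

theorem chain_element_lt {g v : ℕ} (hg : g < w) (hv : v ≤ n + 1) :
    g * (n + 2) + v < w * (n + 2) := by
  have := Nat.mul_le_mul_right (n + 2) (Nat.succ_le_of_lt hg)
  rw [Nat.succ_mul] at this; omega

theorem covers_chain {Sat : ℕ → ℕ → ℕ → ℕ → Prop} {ℓ g v : ℕ} (hg : g < w) (hv : v ≤ n + 1) :
    Covers n w Sat ℓ (g * (n + 2) + v) ↔
      (idx n ℓ = g ∧ fst n ℓ < snd n ℓ ∧ snd n ℓ ≤ v) ∨ (idx n ℓ = g + 1 ∧ v < fst n ℓ) := by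
  unfold Covers
  rw [if_pos (chain_element_lt hg hv), mul_comm, Nat.mul_add_mod, Nat.mod_eq_of_lt (by omega),
    Nat.mul_add_div (by omega), Nat.div_eq_of_lt (by omega : v < n + 2), add_zero]

theorem covers_clause {Sat : ℕ → ℕ → ℕ → ℕ → Prop} {ℓ j : ℕ} :
    Covers n w Sat ℓ (w * (n + 2) + j) ↔ Sat j (idx n ℓ) (fst n ℓ) (snd n ℓ) := by
  unfold Covers
  rw [if_neg (by omega), Nat.add_sub_cancel_left]

/-- A small cover is a chain of sets. -/
theorem exists_chain_of_cover {m : ℕ} {Sat : ℕ → ℕ → ℕ → ℕ → Prop} {S : Finset ℕ}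
    (hS : S.card ≤ w + 1) (hlt : ∀ ℓ ∈ S, ℓ < (w + 1) * (n + 1) * (n + 2))
    (hcov : ∀ j < w * (n + 2) + m, ∃ ℓ ∈ S, Covers n w Sat ℓ j) :
    ∃ A B : ℕ → ℕ, (∀ i, A i ≤ n) ∧ (∀ i < w, A i < B i ∧ B i ≤ A (i + 1)) ∧
      (∀ ℓ ∈ S, fst n ℓ = A (idx n ℓ) ∧ snd n ℓ = B (idx n ℓ)) := by
  have hex : 0 < w → ∀ i ≤ w, ∃ ℓ ∈ S, idx n ℓ = i := by
    intro hw i hi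
    rcases hi.lt_or_eq with hi | rfl
    -- The element `(i, n + 1)` cannot be covered from index `i + 1`, as first components are at
    -- most `n`.
    · have hle := le_refl (n + 1)
      obtain ⟨ℓ, hℓ, hc⟩ := hcov _ ((chain_element_lt hi hle).trans_le (Nat.le_add_right _ _))
      rcases (covers_chain hi hle).1 hc with h | h
      · exact ⟨ℓ, hℓ, h.1⟩
      · have := fst_le (n := n) ℓ; omega
    -- The last index is forced by the element `(w - 1, 0)`: a set of index `w - 1` would need `fst
    -- < snd ≤ 0`.
    · have hi' := Nat.sub_lt hw one_pos
      have hle := Nat.zero_le (n + 1)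
      obtain ⟨ℓ, hℓ, hc⟩ := hcov _ ((chain_element_lt hi' hle).trans_le (Nat.le_add_right _ _))
      rcases (covers_chain hi' hle).1 hc with h | h
      · omega
      · exact ⟨ℓ, hℓ, by omega⟩
  have huniq : ∀ ℓ ∈ S, ∀ ℓ' ∈ S, idx n ℓ = idx n ℓ' → ℓ = ℓ' := by
    rcases Nat.eq_zero_or_pos w with rfl | hw
    · intro ℓ hℓ ℓ' hℓ' _
      exact Finset.card_le_one.1 hS ℓ hℓ ℓ' hℓ'
    -- All `w + 1` indices occur among at most `w + 1` sets, so `idx` is injective on `S`.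
    · have h1 : Finset.range (w + 1) ⊆ S.image (idx n) := by
        intro i hi
        obtain ⟨ℓ, hℓ, h⟩ := hex hw i (by simpa [Nat.lt_succ_iff] using hi)
        exact Finset.mem_image.2 ⟨ℓ, hℓ, h⟩
      have h2 := Finset.card_le_card h1
      rw [Finset.card_range] at h2
      have h3 : (S.image (idx n)).card = S.card :=
        le_antisymm Finset.card_image_le (hS.trans h2)
      intro ℓ hℓ ℓ' hℓ' h
      exact Finset.card_image_iff.1 h3 hℓ hℓ' h
  have hf : ∀ i, ∃ ℓ, (∃ ℓ' ∈ S, idx n ℓ' = i) → ℓ ∈ S ∧ idx n ℓ = i := by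
    intro i
    by_cases h : ∃ ℓ' ∈ S, idx n ℓ' = i
    · obtain ⟨ℓ, h1, h2⟩ := h
      exact ⟨ℓ, fun _ => ⟨h1, h2⟩⟩
    -- A junk value, for indices beyond `w`, or for a possibly empty cover when `w = 0`.
    · exact ⟨0, fun h' => absurd h' h⟩
  choose f hf using hf
  have hfu : ∀ ℓ ∈ S, ℓ = f (idx n ℓ) := fun ℓ hℓ =>
    huniq ℓ hℓ _ (hf _ ⟨ℓ, hℓ, rfl⟩).1 (hf _ ⟨ℓ, hℓ, rfl⟩).2.symm
  refine ⟨fun i => fst n (f i), fun i => snd n (f i), fun i => fst_le _, fun i hi => ?_,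
    fun ℓ hℓ => by simp only [← hfu ℓ hℓ, and_self]⟩
  -- At the element `(i, A (i + 1))` the second way of being covered would read `A (i + 1) < A (i +
  -- 1)`, so the first one holds and is the chain condition.
  have hle : fst n (f (i + 1)) ≤ n + 1 := (fst_le _).trans (Nat.le_succ n)
  obtain ⟨ℓ, hℓ, hc⟩ := hcov _ ((chain_element_lt hi hle).trans_le (Nat.le_add_right _ _))
  rcases (covers_chain hi hle).1 hc with h | h
  · have h4 := h.2
    rw [hfu ℓ hℓ, h.1] at h4
    exact h4
  · have h4 := h.2
    rw [hfu ℓ hℓ, h.1] at h4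
    omega

theorem chain_lt {A B : ℕ → ℕ} (hAB : ∀ i < w, A i < B i ∧ B i ≤ A (i + 1)) {i j : ℕ} (hij : i < j)
    (hj : j ≤ w) : A i < B i ∧ B i ≤ A j := by
  induction j with
  | zero => omega
  | succ j ih =>
    have h1 := hAB j (by omega)
    rcases Nat.lt_succ_iff_lt_or_eq.1 hij with h | rfl
    · have := ih h (by omega); omega
    · exact h1

theorem cover_iff {m : ℕ} {Sat : ℕ → ℕ → ℕ → ℕ → Prop} (cl : ℕ → List (Fin n × Bool))
    (hSat : ∀ j < m, ∀ i a b, Sat j i a b ↔ ∃ l ∈ cl j, Implies i a b l.1 l.2) :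
    (∃ S : Finset ℕ, S.card ≤ w + 1 ∧ (∀ ℓ ∈ S, ℓ < (w + 1) * (n + 1) * (n + 2)) ∧
        ∀ j < w * (n + 2) + m, ∃ ℓ ∈ S, Covers n w Sat ℓ j) ↔
      ∃ τ : Fin n → Bool, (Finset.univ.filter fun i => τ i = true).card = w ∧
        ∀ j < m, ∃ l ∈ cl j, τ l.1 = l.2 := by
  classical
  constructor
  · rintro ⟨S, hS, hlt, hcov⟩
    obtain ⟨A, B, hA, hAB, hSAB⟩ := exists_chain_of_cover hS hlt hcov
    have hpos : ∀ i, i ≠ 0 → i ≤ w → 0 < A i := fun i h0 hi => by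
      have := chain_lt hAB (Nat.pos_of_ne_zero h0) hi; omega
    -- The true variables are `A 1, ..., A w`; there are exactly `w` because the chain is strictly
    -- increasing.
    refine ⟨fun c => decide (∃ i, i ≠ 0 ∧ i ≤ w ∧ A i = c.val + 1), ?_, fun j hj => ?_⟩
    · refine Eq.trans (Eq.symm ?_) (Finset.card_range w)
      refine Finset.card_bij (fun i hi => ⟨A (i + 1) - 1, by
        have := hA (i + 1)
        have := hpos (i + 1) (by omega) (by simpa using hi)
        omega⟩) (fun i hi => ?_) (fun i hi j hj h => ?_) (fun c hc => ?_)
      · have := hpos (i + 1) (by omega) (by simpa using hi)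
        have hi := Finset.mem_range.1 hi
        simp only [Finset.mem_filter, Finset.mem_univ, true_and, decide_eq_true_eq]
        exact ⟨i + 1, by omega, by omega, by omega⟩
      · have h1 := hpos (i + 1) (by omega) (by simpa using hi)
        have h2 := hpos (j + 1) (by omega) (by simpa using hj)
        rw [Finset.mem_range] at hi hj
        simp only [Fin.mk.injEq] at h
        rcases lt_trichotomy i j with hij | hij | hij
        · have := chain_lt hAB (show i + 1 < j + 1 by omega) (by omega); omega
        · exact hij
        · have := chain_lt hAB (show j + 1 < i + 1 by omega) (by omega); omega
      · simp only [Finset.mem_filter, Finset.mem_univ, true_and, decide_eq_true_eq] at hc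
        obtain ⟨i, h0, hi, h⟩ := hc
        refine ⟨i - 1, Finset.mem_range.2 (by omega), Fin.ext ?_⟩
        simp only [show i - 1 + 1 = i by omega, h, Nat.add_sub_cancel]
    · obtain ⟨ℓ, hℓ, hc⟩ := hcov (w * (n + 2) + j) (by omega)
      rw [covers_clause, hSat j hj] at hc
      obtain ⟨l, hl, hi⟩ := hc
      have hidx := idx_le (hlt ℓ hℓ)
      rw [(hSAB ℓ hℓ).1, (hSAB ℓ hℓ).2] at hi
      generalize idx n ℓ = i at hi hidx
      refine ⟨l, hl, ?_⟩
      rcases hi with ⟨hs, h0, ha⟩ | ⟨hs, ha, hb⟩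
      · rw [hs, decide_eq_true_eq]
        exact ⟨i, h0, hidx, ha⟩
      · rw [hs, decide_eq_false_iff_not]
        rintro ⟨k, h0, hk, he⟩
        -- `c + 1` lies strictly between `A i` and `B i`, and the chain puts no `A k` there.
        rcases lt_trichotomy i k with h | h | h
        · have := chain_lt hAB h hk; omega
        · subst h; omega
        · have := chain_lt hAB h hidx; omega
  · rintro ⟨τ, hw, hτ⟩
    let e := (Finset.univ.filter fun i => τ i = true).orderEmbOfFin hw
    have he : ∀ i, τ (e i) = true := fun i =>
      (Finset.mem_filter.1 (Finset.orderEmbOfFin_mem _ hw i)).2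
    have he' : ∀ c, τ c = true → ∃ i, e i = c := fun c hc => by
      have := Finset.range_orderEmbOfFin (Finset.univ.filter fun i => τ i = true) hw
      have hc' : c ∈ Set.range e := by rw [this]; simpa using hc
      exact hc'
    -- The true variables in increasing order, counted from `1`, with sentinels `0` and `n + 1` at
    -- the ends.
    let t : ℕ → ℕ := fun i => if i = 0 then 0 else
      if h : i - 1 < w then (e ⟨i - 1, h⟩).val + 1 else n + 1
    have ht0 : t 0 = 0 := rfl
    have ht1 : ∀ i (h : i < w), t (i + 1) = (e ⟨i, h⟩).val + 1 := fun i h => by simp [t, h]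
    have ht2 : t (w + 1) = n + 1 := by simp [t]
    have hlt : ∀ i < w, t i < t (i + 1) := by
      intro i hi
      rw [ht1 i hi]
      rcases i with - | i
      · rw [ht0]; omega
      · rw [ht1 i (by omega)]
        have : e ⟨i, by omega⟩ < e ⟨i + 1, hi⟩ := e.strictMono (by simp [Fin.lt_def])
        exact Nat.succ_lt_succ this
    have hle : ∀ i ≤ w, t i ≤ n := by
      intro i hi
      rcases i with - | i
      · rw [ht0]; omega
      · rw [ht1 i (by omega)]; exact (e _).2
    have hle' : ∀ i ≤ w + 1, t i ≤ n + 1 := by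
      intro i hi
      rcases hi.lt_or_eq with hi | rfl
      · have := hle i (by omega); omega
      · rw [ht2]
    let ℓ : ℕ → ℕ := fun i => code n i (t i) (t (i + 1))
    have hℓS : ∀ i ≤ w, ℓ i ∈ (Finset.range (w + 1)).image ℓ := fun i hi =>
      Finset.mem_image_of_mem _ (Finset.mem_range.2 (by omega))
    have hidx : ∀ i ≤ w, idx n (ℓ i) = i := fun i hi => idx_code (hle i hi) (hle' _ (by omega))
    have hfst : ∀ i ≤ w, fst n (ℓ i) = t i := fun i hi => fst_code (hle i hi) (hle' _ (by omega))
    have hsnd : ∀ i ≤ w, snd n (ℓ i) = t (i + 1) := fun i hi => snd_code (hle' _ (by omega))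
    refine ⟨(Finset.range (w + 1)).image ℓ, Finset.card_image_le.trans (by simp), ?_, ?_⟩
    · intro x hx
      obtain ⟨i, hi, rfl⟩ := Finset.mem_image.1 hx
      have hi : i ≤ w := by simpa [Nat.lt_succ_iff] using hi
      exact code_lt hi (hle i hi) (hle' _ (by omega))
    · intro j hj
      by_cases h : j < w * (n + 2)
      · have hg : j / (n + 2) < w := Nat.div_lt_of_lt_mul (by rw [mul_comm]; exact h)
        have hv : j % (n + 2) ≤ n + 1 := Nat.lt_succ_iff.1 (Nat.mod_lt _ (by omega))
        have hj' : j = j / (n + 2) * (n + 2) + j % (n + 2) := (Nat.div_add_mod' _ _).symm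
        generalize j / (n + 2) = g at *
        generalize j % (n + 2) = v at *
        subst hj'
        rcases le_or_gt (t (g + 1)) v with h' | h'
        · refine ⟨ℓ g, hℓS g hg.le, (covers_chain hg hv).2 (.inl ?_)⟩
          rw [hidx g hg.le, hfst g hg.le, hsnd g hg.le]
          exact ⟨rfl, hlt g hg, h'⟩
        · refine ⟨ℓ (g + 1), hℓS _ hg, (covers_chain hg hv).2 (.inr ?_)⟩
          rw [hidx _ hg, hfst _ hg]
          exact ⟨rfl, h'⟩
      · obtain ⟨k, rfl⟩ := Nat.exists_eq_add_of_le (not_lt.1 h)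
        have hk : k < m := by omega
        obtain ⟨⟨c, s⟩, hl, hs⟩ := hτ k hk
        simp only at hs
        have key : ∃ i ≤ w, Implies i (t i) (t (i + 1)) c s := by
          cases s with
          | true =>
            obtain ⟨i, hi⟩ := he' c hs
            exact ⟨i + 1, i.2, .inl ⟨rfl, by omega, by rw [ht1 i i.2]; simp [hi]⟩⟩
          | false =>
            -- Discrete intermediate value: `t 0 = 0 ≤ c < n + 1 = t (w + 1)`. The value `c + 1 = t
            -- (i + 1)` is excluded afterwards, since `c` is false and `c < n`.
            have : ∃ i ≤ w, t i ≤ c ∧ c < t (i + 1) := by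
              by_contra hcon
              push Not at hcon
              have hall : ∀ i ≤ w + 1, t i ≤ c := by
                intro i
                induction i with
                | zero => intro _; rw [ht0]; omega
                | succ i ih => exact fun hi => hcon i (by omega) (ih (by omega))
              have h1 := hall (w + 1) le_rfl
              have h2 := c.2
              omega
            obtain ⟨i, hi, h1, h2⟩ := this
            refine ⟨i, hi, .inr ⟨rfl, h1, lt_of_le_of_ne h2 fun h3 => ?_⟩⟩
            rcases hi.lt_or_eq with hi | rfl
            · rw [ht1 i hi] at h3
              have : e ⟨i, hi⟩ = c := Fin.ext (by omega)
              have := he ⟨i, hi⟩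
              simp_all
            · rw [ht2] at h3; have := c.2; omega
        obtain ⟨i, hi, himp⟩ := key
        refine ⟨ℓ i, hℓS i hi, covers_clause.2 ((hSat k hk _ _ _).2 ⟨(c, s), hl, ?_⟩)⟩
        rwa [hidx i hi, hfst i hi, hsnd i hi]

end

section

/-! ### Reading a formula -/

/-- One step of the automaton that reads an encoded formula. States: `0` and `1` read the number of
variables and the weight, `2` is at the front of the list of clauses, `3` at the front of a list of
literals, `4` reads a variable, `5` a sign, and `6` is the end. -/
def stepState (s b : ℕ) : ℕ :=
  if s = 0 then (if b = 2 then 0 else 1)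
  else if s = 1 then (if b = 2 then 1 else 2)
  else if s = 2 then (if b = 2 then 3 else 6)
  else if s = 3 then (if b = 2 then 4 else 2)
  else if s = 4 then (if b = 2 then 4 else 5)
  else if s = 5 then 3 else 6

/-- The state before position `p`. -/
def stateAt (u : List Bool) : ℕ → ℕ
  | 0 => 0
  | p + 1 => stepState (stateAt u p) (sym u p)

/-- The part of the current variable that was read before position `p`. -/
def countAt (u : List Bool) : ℕ → ℕ
  | 0 => 0
  | p + 1 => if stateAt u p = 3 then 0
      else if stateAt u p = 4 ∧ sym u p = 2 then countAt u p + 1 else countAt u p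

/-- How often the bit `1` was read in state `s` before position `p`. -/
def ones (u : List Bool) (s p : ℕ) : ℕ :=
  ∑ k ∈ Finset.range p, if stateAt u k = s ∧ sym u k = 2 then 1 else 0

theorem ones_succ (u : List Bool) (s p : ℕ) :
    ones u s (p + 1) = ones u s p + if stateAt u p = s ∧ sym u p = 2 then 1 else 0 :=
  Finset.sum_range_succ _ _

/-- Between the positions `p` and `q` the automaton reads in clause `j` the literal `(c, s)`. -/
def Reads (u : List Bool) (p q j c : ℕ) (s : Bool) : Prop :=
  ∃ r, p ≤ r ∧ r < q ∧ stateAt u r = 5 ∧ ones u 2 r = j ∧ countAt u r = c ∧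
    sym u r = s.toNat + 1

variable {u v : List Bool} {p q r : ℕ}

theorem Reads.trans_iff (hpq : p ≤ q) (hqr : q ≤ r) (j c : ℕ) (s : Bool) :
    Reads u p r j c s ↔ Reads u p q j c s ∨ Reads u q r j c s := by
  constructor
  · rintro ⟨k, h1, h2, h⟩
    rcases lt_or_ge k q with hk | hk
    · exact .inl ⟨k, h1, hk, h⟩
    · exact .inr ⟨k, hk, h2, h⟩
  · rintro (⟨k, h1, h2, h⟩ | ⟨k, h1, h2, h⟩)
    · exact ⟨k, h1, by omega, h⟩
    · exact ⟨k, by omega, h2, h⟩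

theorem Reads.succ_iff (j c : ℕ) (s : Bool) :
    Reads u p (p + 1) j c s ↔ stateAt u p = 5 ∧ ones u 2 p = j ∧ countAt u p = c ∧
      sym u p = s.toNat + 1 := by
  constructor
  · rintro ⟨k, h1, h2, h⟩
    obtain rfl : k = p := by omega
    exact h
  · exact fun h => ⟨p, le_rfl, by omega, h⟩

theorem sym_of_drop {b : Bool} (h : u.drop p = b :: v) :
    sym u p = b.toNat + 1 ∧ u.drop (p + 1) = v := by
  constructor
  · have : u[p]? = some b := by
      rw [← List.head?_drop, h]; rfl
    simp [sym, this]
  · rw [← List.tail_drop, h]; rfl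

theorem encNat_zero_append (v : List Bool) : encNat 0 ++ v = false :: v := rfl

theorem encNat_succ_append (c : ℕ) (v : List Bool) :
    encNat (c + 1) ++ v = true :: (encNat c ++ v) := by
  simp [encNat, List.replicate_succ]

/-- Reading a number. -/
theorem read_nat {s : ℕ} (hs : s = 0 ∨ s = 1 ∨ s = 4) (c : ℕ) :
    ∀ p, u.drop p = encNat c ++ v → stateAt u p = s →
      ∃ q, p ≤ q ∧ u.drop q = v ∧ stateAt u q = s + 1 ∧ ones u s q = ones u s p + c ∧
        (∀ s', s' ≠ s → ones u s' q = ones u s' p) ∧ (s = 4 → countAt u q = countAt u p + c) ∧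
        ∀ j c s, ¬ Reads u p q j c s := by
  have hstep : ∀ p, stateAt u p = s → ∀ j c s, ¬ Reads u p (p + 1) j c s := by
    intro p hp j c s' h
    rw [Reads.succ_iff] at h
    omega
  induction c with
  | zero =>
    intro p hd hp
    rw [encNat_zero_append] at hd
    obtain ⟨h1, h2⟩ := sym_of_drop hd
    simp only [Bool.toNat_false, zero_add] at h1
    refine ⟨p + 1, by omega, h2, ?_, ?_, fun s' hs' => ?_, fun h4 => ?_, hstep p hp⟩
    · simp only [stateAt, stepState, hp, h1]; rcases hs with rfl | rfl | rfl <;> simp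
    · simp [ones_succ, h1]
    · simp [ones_succ, h1]
    · simp [countAt, hp, h4, h1]
  | succ c ih =>
    intro p hd hp
    rw [encNat_succ_append] at hd
    obtain ⟨h1, h2⟩ := sym_of_drop hd
    simp only [Bool.toNat_true, Nat.reduceAdd] at h1
    have hp' : stateAt u (p + 1) = s := by
      simp only [stateAt, stepState, hp, h1]; rcases hs with rfl | rfl | rfl <;> simp
    obtain ⟨q, k1, k2, k3, k4, k5, k6, k7⟩ := ih (p + 1) h2 hp'
    refine ⟨q, by omega, k2, k3, ?_, fun s' hs' => ?_, fun h4 => ?_, fun j c s h => ?_⟩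
    · rw [k4, ones_succ, if_pos ⟨hp, h1⟩]; omega
    · rw [k5 s' hs', ones_succ, if_neg (by omega), add_zero]
    · rw [k6 h4]; simp only [countAt, hp, h4, h1]; simp; omega
    · rw [Reads.trans_iff (by omega : p ≤ p + 1) k1] at h
      exact h.elim (hstep p hp j c s) (k7 j c s)

/-- Reading a literal. -/
theorem read_literal {n : ℕ} (l : Fin n × Bool)
    (hd : u.drop p = true :: (encPair encFin encBool l ++ v)) (hp : stateAt u p = 3) :
    ∃ q, p ≤ q ∧ u.drop q = v ∧ stateAt u q = 3 ∧ (∀ s, s < 3 → ones u s q = ones u s p) ∧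
      ∀ j c s, Reads u p q j c s ↔ j = ones u 2 p ∧ c = l.1 ∧ s = l.2 := by
  obtain ⟨h1, h2⟩ := sym_of_drop hd
  simp only [Bool.toNat_true, Nat.reduceAdd] at h1
  have hp' : stateAt u (p + 1) = 4 := by simp [stateAt, stepState, hp, h1]
  simp only [encPair, encFin, encBool, List.append_assoc, List.singleton_append] at h2
  obtain ⟨q, k1, k2, k3, -, k5, k6, k7⟩ := read_nat (by simp) l.1.val (p + 1) h2 hp'
  obtain ⟨h3, h4⟩ := sym_of_drop k2
  -- The counter is reset in state `3`, so it holds exactly this variable when the sign at position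
  -- `q` is reached.
  have hc : countAt u q = l.1 := by rw [k6 rfl]; simp [countAt, hp]
  have ho : ∀ s, s < 3 → ones u s q = ones u s p := fun s hs => by
    rw [k5 s (by omega), ones_succ, if_neg (by omega), add_zero]
  refine ⟨q + 1, by omega, h4, by simp [stateAt, stepState, k3], fun s hs => ?_,
    fun j c s => ?_⟩
  · rw [ones_succ, if_neg (by omega), add_zero, ho s hs]
  · rw [Reads.trans_iff (by omega : p ≤ q) (by omega : q ≤ q + 1),
      Reads.trans_iff (by omega : p ≤ p + 1) k1, Reads.succ_iff, Reads.succ_iff]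
    have := k7 j c s
    rw [h3, hc, ho 2 (by omega), k3, hp]
    have hb : l.2.toNat + 1 = s.toNat + 1 ↔ s = l.2 := by
      cases s <;> cases l.2 <;> simp
    rw [hb]
    constructor
    · rintro ((h | h) | h)
      · omega
      · exact absurd h this
      · exact ⟨h.2.1.symm, h.2.2.1.symm, h.2.2.2⟩
    · rintro ⟨rfl, rfl, rfl⟩
      exact .inr ⟨rfl, rfl, rfl, rfl⟩

/-- Reading a clause. -/
theorem read_clause {n : ℕ} (C : List (Fin n × Bool)) :
    ∀ p, u.drop p = encList (encPair encFin encBool) C ++ v → stateAt u p = 3 →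
      ∃ q, p ≤ q ∧ u.drop q = v ∧ stateAt u q = 2 ∧ (∀ s, s < 3 → ones u s q = ones u s p) ∧
        ∀ j c s, Reads u p q j c s ↔ j = ones u 2 p ∧ ∃ l ∈ C, c = l.1.val ∧ s = l.2 := by
  induction C with
  | nil =>
    intro p hd hp
    obtain ⟨h1, h2⟩ := sym_of_drop hd
    simp only [Bool.toNat_false, zero_add] at h1
    refine ⟨p + 1, by omega, h2, by simp [stateAt, stepState, hp, h1], fun s _ => ?_,
      fun j c s => ?_⟩
    · simp [ones_succ, h1]
    · simp [Reads.succ_iff, hp]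
  | cons l C ih =>
    intro p hd hp
    rw [encList, List.cons_append, List.append_assoc] at hd
    obtain ⟨q, k1, k2, k3, k4, k5⟩ := read_literal l hd hp
    obtain ⟨r, m1, m2, m3, m4, m5⟩ := ih q k2 k3
    refine ⟨r, by omega, m2, m3, fun s hs => by rw [m4 s hs, k4 s hs], fun j c s => ?_⟩
    rw [Reads.trans_iff k1 m1, k5, m5, k4 2 (by omega)]
    simp only [List.mem_cons, exists_eq_or_imp]
    tauto

/-- Reading a list of clauses. -/
theorem read_clauses {n : ℕ} (Cs : List (List (Fin n × Bool))) :
    ∀ p, u.drop p = encList (encList (encPair encFin encBool)) Cs ++ v → stateAt u p = 2 →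
      ∃ q, p ≤ q ∧ u.drop q = v ∧ stateAt u q = 6 ∧
        ones u 2 q = ones u 2 p + Cs.length ∧ (∀ s, s < 2 → ones u s q = ones u s p) ∧
        ∀ k c s, Reads u p q (ones u 2 p + k) c s ↔
          ∃ j C, k = j + 1 ∧ Cs[j]? = some C ∧ ∃ l ∈ C, c = l.1.val ∧ s = l.2 := by
  induction Cs with
  | nil =>
    intro p hd hp
    obtain ⟨h1, h2⟩ := sym_of_drop hd
    simp only [Bool.toNat_false, zero_add] at h1
    refine ⟨p + 1, by omega, h2, by simp [stateAt, stepState, hp, h1], ?_, fun s _ => ?_,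
      fun j c s => ?_⟩
    · simp [ones_succ, h1]
    · simp [ones_succ, h1]
    · simp [Reads.succ_iff, hp]
  | cons C Cs ih =>
    intro p hd hp
    rw [encList, List.cons_append, List.append_assoc] at hd
    obtain ⟨h1, h2⟩ := sym_of_drop hd
    simp only [Bool.toNat_true, Nat.reduceAdd] at h1
    have hp' : stateAt u (p + 1) = 3 := by simp [stateAt, stepState, hp, h1]
    obtain ⟨q, k1, k2, k3, k4, k5⟩ := read_clause C (p + 1) h2 hp'
    obtain ⟨r, m1, m2, m3, m4, m5, m6⟩ := ih q k2 k3
    have ho : ones u 2 (p + 1) = ones u 2 p + 1 := by rw [ones_succ, if_pos ⟨hp, h1⟩]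
    have hoq : ones u 2 q = ones u 2 p + 1 := by rw [k4 2 (by omega), ho]
    refine ⟨r, by omega, m2, m3, ?_, fun s hs => ?_, fun k c s => ?_⟩
    · rw [m4, hoq, List.length_cons]; omega
    · rw [m5 s hs, k4 s (by omega), ones_succ, if_neg (by omega), add_zero]
    · rw [Reads.trans_iff (by omega : p ≤ q) m1, Reads.trans_iff (by omega : p ≤ p + 1) k1,
        Reads.succ_iff, k5, ho, hp]
      have hm : Reads u q r (ones u 2 p + k) c s ↔
          ∃ j C, k = j + 1 + 1 ∧ Cs[j]? = some C ∧ ∃ l ∈ C, c = l.1.val ∧ s = l.2 := by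
        -- The clause counter has already passed `ones u 2 p` at `q` and never decreases, so `k = 0`
        -- is impossible in the later part.
        rcases k with - | k
        · constructor
          · rintro ⟨i, h1, h2, h3, h4, -⟩
            have : ones u 2 q ≤ ones u 2 i :=
              Finset.sum_le_sum_of_subset (Finset.range_mono h1)
            omega
          · rintro ⟨j, C, h, -⟩; omega
        · have := m6 k c s
          rw [hoq, add_assoc, add_comm 1 k] at this
          rw [this]
          simp only [Nat.add_right_cancel_iff]
      rw [hm]
      constructor
      · rintro ((h | ⟨h, h'⟩) | ⟨j, D, rfl, h, h'⟩)
        · omega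
        · exact ⟨0, C, by omega, by simp, h'⟩
        · exact ⟨j + 1, D, rfl, by simpa using h, h'⟩
      · rintro ⟨j, D, rfl, h, h'⟩
        rcases j with - | j
        · obtain rfl : C = D := by simpa using h
          exact .inl (.inr ⟨rfl, h'⟩)
        · exact .inr ⟨j, D, rfl, by simpa using h, h'⟩

/-- The number of variables. -/
def varsOf (u : List Bool) : ℕ := ones u 0 u.length

/-- The weight. -/
def weightOf (u : List Bool) : ℕ := ones u 1 u.length

/-- The number of clauses. -/
def clausesOf (u : List Bool) : ℕ := ones u 2 u.length

/-- The set `(i, a, b)` implies a literal of the clause `j`. -/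
def SatisfiesIn (u : List Bool) (j i a b : ℕ) : Prop :=
  ∃ p < u.length, (stateAt u p = 5 ∧ ones u 2 p = j + 1) ∧
    ((sym u p = 2 ∧ i ≠ 0 ∧ a = countAt u p + 1) ∨
      (sym u p = 1 ∧ a ≤ countAt u p ∧ countAt u p + 1 < b))

/-- Past the end the symbol is `0`, which is neither bit; it is thus enough that parsing stops at or
after the end. -/
theorem ones_eq_of_length_le (s : ℕ) (h : u.length ≤ p) : ones u s p = ones u s u.length := by
  obtain ⟨k, rfl⟩ := Nat.exists_eq_add_of_le h
  induction k with
  | zero => rfl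
  | succ k ih =>
    rw [← add_assoc, ones_succ, ih (by omega), sym_of_le (by omega)]
    simp

theorem parse_encode {q : ℕ} (I : CNFInst q) :
    varsOf I.encode = I.vars ∧ weightOf I.encode = I.weight ∧
      clausesOf I.encode = I.clauses.length ∧ ∀ j < I.clauses.length, ∀ i a b,
        SatisfiesIn I.encode j i a b ↔ ∃ l ∈ I.clauses.getD j [], Implies i a b l.1 l.2 := by
  set u := I.encode with hu
  obtain ⟨q1, a1, a2, a3, a4, a5, -, a7⟩ := read_nat (u := u) (s := 0) (by simp) I.vars 0 hu rfl
  obtain ⟨q2, b1, b2, b3, b4, b5, -, b7⟩ := read_nat (s := 1) (by simp) I.weight q1 a2 a3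
  rw [← List.append_nil (encList _ _)] at b2
  obtain ⟨q3, c1, c2, c3, c4, c5, c6⟩ := read_clauses I.clauses q2 b2 b3
  have hlen : u.length ≤ q3 := by simpa using c2
  have h0 : ∀ s, ones u s 0 = 0 := fun s => rfl
  have h2 : ones u 2 q2 = 0 := by rw [b5 2 (by omega), a5 2 (by omega), h0]
  refine ⟨?_, ?_, ?_, fun j hj i a b => ?_⟩
  · rw [varsOf, ← ones_eq_of_length_le 0 hlen, c5 0 (by omega), b5 0 (by omega), a4, h0, zero_add]
  · rw [weightOf, ← ones_eq_of_length_le 1 hlen, c5 1 (by omega), b4, a5 1 (by omega), h0, zero_add]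
  · rw [clausesOf, ← ones_eq_of_length_le 2 hlen, c4, h2, zero_add]
  · have hreads : ∀ c s, Reads u 0 q3 (j + 1) c s ↔
        ∃ l ∈ I.clauses.getD j [], c = l.1.val ∧ s = l.2 := by
      intro c s
      have h6 := c6 (j + 1) c s
      rw [h2, zero_add] at h6
      rw [Reads.trans_iff (by omega : 0 ≤ q2) c1, Reads.trans_iff a1 b1, h6]
      have e1 := a7 (j + 1) c s
      have e2 := b7 (j + 1) c s
      constructor
      · rintro ((h | h) | ⟨j', C, hj', hC, h⟩)
        · exact absurd h e1
        · exact absurd h e2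
        · obtain rfl : j = j' := by omega
          simpa [List.getD, hC] using h
      · intro h
        exact .inr ⟨j, I.clauses[j], rfl, by simp [hj], by simpa [List.getD, hj] using h⟩
    constructor
    · rintro ⟨p, hp, ⟨h5, ho⟩, h⟩
      rcases h with ⟨hs, h⟩ | ⟨hs, h⟩
      · obtain ⟨l, hl, hc, hs'⟩ := (hreads (countAt u p) true).1
          ⟨p, by omega, by omega, h5, ho, rfl, by simpa using hs⟩
        exact ⟨l, hl, .inl ⟨hs'.symm, h.1, by rw [← hc]; exact h.2⟩⟩
      · obtain ⟨l, hl, hc, hs'⟩ := (hreads (countAt u p) false).1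
          ⟨p, by omega, by omega, h5, ho, rfl, by simpa using hs⟩
        exact ⟨l, hl, .inr ⟨hs'.symm, by rw [← hc]; exact h⟩⟩
    · rintro ⟨l, hl, h⟩
      obtain ⟨p, -, hp, h5, ho, hc, hs⟩ := (hreads l.1 l.2).2 ⟨l, hl, rfl, rfl⟩
      have hpl : p < u.length := by
        by_contra hcon
        rw [sym_of_le (by omega)] at hs
        omega
      refine ⟨p, hpl, ⟨h5, ho⟩, ?_⟩
      rw [hc]
      rcases h with ⟨h1, h⟩ | ⟨h1, h⟩
      · exact .inl ⟨by rw [hs, h1]; rfl, h⟩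
      · exact .inr ⟨by rw [hs, h1]; rfl, h⟩

end

section

/-! ### The reduction -/

variable {Γ : Type} [Ctx Γ]

theorem PolyPred.ite {p q r : List Bool → Γ → Prop} [∀ w x, Decidable (p w x)] (hp : PolyPred p)
    (hq : PolyPred q) (hr : PolyPred r) :
    PolyPred (fun w x => if p w x then q w x else r w x) :=
  ((hp.and hq).or (hp.not.and hr)).congr fun w x => by by_cases h : p w x <;> simp [h]

theorem polyComp_stepState {F G : List Bool → Γ → ℕ} (hF : PolyComp F) (hG : PolyComp G) :
    PolyComp (fun w x => stepState (F w x) (G w x)) := by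
  have h2 : PolyPred (fun w x => G w x = 2) := .eq hG (.const 2)
  have h : ∀ n, PolyPred (fun w x => F w x = n) := fun n => .eq hF (.const n)
  exact .ite (h 0) (.ite h2 (.const 0) (.const 1)) <| .ite (h 1) (.ite h2 (.const 1) (.const 2)) <|
    .ite (h 2) (.ite h2 (.const 3) (.const 6)) <| .ite (h 3) (.ite h2 (.const 4) (.const 2)) <|
    .ite (h 4) (.ite h2 (.const 4) (.const 5)) <| .ite (h 5) (.const 3) (.const 6)

theorem stepState_le (s b : ℕ) : stepState s b ≤ 6 := by
  unfold stepState; split_ifs <;> omega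

theorem polyComp_stateAt {F : List Bool → Γ → ℕ} (hF : PolyComp F) :
    PolyComp (fun w x => stateAt w (F w x)) := by
  refine PolyComp.recursion (g := fun _ _ => 0) (h := fun w y => stepState y.2 (sym w y.1.2))
    (fun w _ p => stateAt w p) hF (.const 0)
    (polyComp_stepState .last (PolyComp.last.weaken.sym)) (fun _ _ => rfl) (fun _ _ _ => rfl)
    ⟨6, fun w x B _ k _ => ?_⟩
  refine le_trans ?_ (le_pow_self_add_two 6 B)
  cases k with
  | zero => simp [stateAt]
  | succ k => exact stepState_le _ _

theorem countAt_le (u : List Bool) (p : ℕ) : countAt u p ≤ p := by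
  induction p with
  | zero => simp [countAt]
  | succ p ih => simp only [countAt]; split_ifs <;> omega

theorem polyComp_countAt {F : List Bool → Γ → ℕ} (hF : PolyComp F) :
    PolyComp (fun w x => countAt w (F w x)) := by
  have hs : PolyComp (fun w (y : (Γ × ℕ) × ℕ) => stateAt w y.1.2) :=
    polyComp_stateAt PolyComp.last.weaken
  have hc : PolyPred (fun w (y : (Γ × ℕ) × ℕ) => sym w y.1.2 = 2) :=
    .eq PolyComp.last.weaken.sym (.const 2)
  refine PolyComp.recursion (g := fun _ _ => 0) (h := fun w y => if stateAt w y.1.2 = 3 then 0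
      else if stateAt w y.1.2 = 4 ∧ sym w y.1.2 = 2 then y.2 + 1 else y.2)
    (fun w _ p => countAt w p) hF (.const 0) ?_ (fun _ _ => rfl) (fun _ _ _ => rfl) ?_
  · exact .ite (.eq hs (.const 3)) (.const 0)
      (.ite (.and (.eq hs (.const 4)) hc) (.add .last (.const 1)) .last)
  · obtain ⟨a, ha⟩ := hF.1
    exact ⟨a, fun w x B hB k hk => (countAt_le w k).trans (hk.trans (ha w x B hB))⟩

theorem polyComp_ones (s : ℕ) {F : List Bool → Γ → ℕ} (hF : PolyComp F) :
    PolyComp (fun w x => ones w s (F w x)) :=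
  .sum (F := fun w _ k => if stateAt w k = s ∧ sym w k = 2 then 1 else 0) hF
    (.ite (.and (.eq (polyComp_stateAt .last) (.const s)) (.eq PolyComp.last.sym (.const 2)))
      (.const 1) (.const 0))

theorem polyComp_varsOf : PolyComp (fun w (_ : Γ) => varsOf w) := polyComp_ones 0 .length

theorem polyComp_weightOf : PolyComp (fun w (_ : Γ) => weightOf w) := polyComp_ones 1 .length

theorem polyComp_clausesOf : PolyComp (fun w (_ : Γ) => clausesOf w) := polyComp_ones 2 .length

theorem polyPred_satisfiesIn {J I A B : List Bool → Γ → ℕ} (hJ : PolyComp J) (hI : PolyComp I)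
    (hA : PolyComp A) (hB : PolyComp B) :
    PolyPred (fun w x => SatisfiesIn w (J w x) (I w x) (A w x) (B w x)) := by
  have hs : PolyComp (fun w (y : Γ × ℕ) => sym w y.2) := PolyComp.last.sym
  have hc : PolyComp (fun w (y : Γ × ℕ) => countAt w y.2) := polyComp_countAt .last
  refine PolyPred.exists_lt (p := fun w x p => (stateAt w p = 5 ∧ ones w 2 p = J w x + 1) ∧
    ((sym w p = 2 ∧ I w x ≠ 0 ∧ A w x = countAt w p + 1) ∨
      (sym w p = 1 ∧ A w x ≤ countAt w p ∧ countAt w p + 1 < B w x))) .length ?_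
  refine .and (.and (.eq (polyComp_stateAt .last) (.const 5))
    (.eq (polyComp_ones 2 .last) (.add hJ.weaken (.const 1)))) (.or ?_ ?_)
  · exact .and (.eq hs (.const 2)) (.and (.ne hI.weaken (.const 0))
      (.eq hA.weaken (.add hc (.const 1))))
  · exact .and (.eq hs (.const 1)) (.and (.le hA.weaken hc)
      (.lt (.add hc (.const 1)) hB.weaken))

open Classical in
/-- The set system of an encoded formula. -/
noncomputable def incidence (u : List Bool) (ℓ j : ℕ) : Bool :=
  decide (Covers (varsOf u) (weightOf u) (SatisfiesIn u) ℓ j)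

/-- The number of sets. -/
def setsOf (u : List Bool) : ℕ := (weightOf u + 1) * (varsOf u + 1) * (varsOf u + 2)

/-- The number of elements. -/
def elementsOf (u : List Bool) : ℕ := weightOf u * (varsOf u + 2) + clausesOf u

theorem polyComp_setsOf : PolyComp (fun w (_ : Γ) => setsOf w) :=
  .mul (.mul (.add polyComp_weightOf (.const 1)) (.add polyComp_varsOf (.const 1)))
    (.add polyComp_varsOf (.const 2))

theorem polyComp_elementsOf : PolyComp (fun w (_ : Γ) => elementsOf w) :=
  .add (.mul polyComp_weightOf (.add polyComp_varsOf (.const 2))) polyComp_clausesOf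

theorem polyPred_incidence {F G : List Bool → Γ → ℕ} (hF : PolyComp F) (hG : PolyComp G) :
    PolyPred (fun w x => incidence w (F w x) (G w x) = true) := by
  have hn : PolyComp (fun w (_ : Γ) => varsOf w + 2) := .add polyComp_varsOf (.const 2)
  have hn' : PolyComp (fun w (_ : Γ) => varsOf w + 1) := .add polyComp_varsOf (.const 1)
  have hi : PolyComp (fun w x => idx (varsOf w) (F w x)) := .div (.div hF hn) hn'
  have ha : PolyComp (fun w x => fst (varsOf w) (F w x)) := .mod (.div hF hn) hn'
  have hb : PolyComp (fun w x => snd (varsOf w) (F w x)) := .mod hF hn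
  have hw : PolyComp (fun w (_ : Γ) => weightOf w * (varsOf w + 2)) := .mul polyComp_weightOf hn
  have hg := hG.div hn
  have hv := hG.mod hn
  have key : PolyPred (fun w x => Covers (varsOf w) (weightOf w) (SatisfiesIn w)
      (F w x) (G w x)) :=
    .ite (.lt hG hw) (.or (.and (.eq hi hg) (.and (.lt ha hb) (.le hb hv)))
      (.and (.eq hi (.add hg (.const 1))) (.lt hv ha)))
      (polyPred_satisfiesIn (.sub hG hw) hi ha hb)
  exact key.congr fun w x => by simp [incidence]

theorem polyComp_cells : PolyComp (fun w (_ : Γ) => setsOf w * elementsOf w) :=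
  .mul polyComp_setsOf polyComp_elementsOf

theorem PolyComp.add_const {F : List Bool → Γ → ℕ} (hF : PolyComp F) (n : ℕ) :
    PolyComp (fun w x => F w x + n) := hF.add (.const n)

theorem PolyComp.const_mul (n : ℕ) {F : List Bool → Γ → ℕ} (hF : PolyComp F) :
    PolyComp (fun w x => n * F w x) := (PolyComp.const n).mul hF

theorem polyComp_cellTarget {F : List Bool → Γ → ℕ} (hF : PolyComp F) :
    PolyComp (fun w x => cellTarget (setsOf w) (setsOf w * elementsOf w) (incidence w) (F w x)) := by
  have hq := hF.div polyComp_setsOf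
  have h2 := PolyComp.const_mul 2 (polyComp_cells (Γ := Γ))
  exact .ite (polyPred_incidence (hF.mod polyComp_setsOf) hq) (.add (h2.add_const 5) hq)
    (h2.add_const 4)

theorem polyComp_target {F : List Bool → Γ → ℕ} (hF : PolyComp F) :
    PolyComp (fun w x => target (setsOf w) (setsOf w * elementsOf w) (incidence w) (F w x)) := by
  have h1 := polyComp_cells (Γ := Γ)
  have h2 := PolyComp.const_mul 2 h1
  exact .ite (.and (.le (.const 2) hF) (.le hF (h1.add_const 1)))
    (polyComp_cellTarget (hF.sub (.const 2)))
    (.ite (.and (.le (h1.add_const 3) hF) (.le hF (h2.add_const 2)))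
      (polyComp_cellTarget (hF.sub (h1.add_const 3))) (.const 0))

theorem polyPred_link {F G : List Bool → Γ → ℕ} (hF : PolyComp F) (hG : PolyComp G) :
    PolyPred (fun w x => Link (setsOf w) (setsOf w * elementsOf w) (incidence w)
      (F w x) (G w x)) := by
  have h2 := PolyComp.const_mul 2 (polyComp_cells (Γ := Γ))
  have key : ∀ {F G : List Bool → Γ → ℕ}, PolyComp F → PolyComp G → PolyPred (fun w x =>
      Arc (setsOf w) (setsOf w * elementsOf w) (incidence w) (F w x) (G w x)) := by
    intro F G hF hG
    exact .and (.le (.const 1) hF) (.and (.le hF (h2.add_const 3)) (.or (.eq hG (.const 0))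
      (.or (.eq hG (polyComp_target hF)) (.eq hG (hF.add_const 1)))))
  exact .or (key hF hG) (key hG hF)

theorem polyPred_cost {X F G : List Bool → Γ → ℕ} (hX : PolyComp X) (hF : PolyComp F)
    (hG : PolyComp G) :
    PolyPred (fun w x => cost (setsOf w) (setsOf w * elementsOf w) (incidence w)
      (X w x) (F w x) (G w x) = true) := by
  have h1 := polyComp_cells (Γ := Γ)
  have h2 := PolyComp.const_mul 2 h1
  have key : ∀ {F G : List Bool → Γ → ℕ}, PolyComp F → PolyComp G → PolyPred (fun w x =>
      Through (setsOf w) (setsOf w * elementsOf w) (incidence w) (X w x) (F w x) (G w x)) := by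
    intro F G hF hG
    refine .ite (.eq hX (.const 0)) ?_ (.ite (.le hX (h2.add_const 3)) ?_ ?_)
    · exact .and (.eq hG (.add hF (.sub (h1.add_const 1) polyComp_setsOf)))
        (.and (.le (polyComp_setsOf.add_const 2) hF) (.le hF (h1.add_const 1)))
    · exact .or (.and (.eq (hF.add_const 1) hX) (.eq hG (hX.add_const 1)))
        (.and (.eq hF (.const 0)) (.and (.eq hG (polyComp_target hX)) (.ne hG (.const 0))))
    · exact .and (.eq hG (.add hF (h1.add_const 1)))
        (.and (.le (.const 2) hF) (.le hF (h1.add_const 1)))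
  exact (PolyPred.or (key hF hG) (key hG hF)).not.congr fun w x => by simp [cost]

theorem setsOf_pos (u : List Bool) : 0 < setsOf u := by unfold setsOf; positivity

/-- The milling instance of an encoded formula. -/
noncomputable def millInst (u : List Bool) : DiscreteMillingInst where
  n := 2 * (setsOf u * elementsOf u) + 5 + elementsOf u
  G := millGraph (setsOf u) (elementsOf u) (incidence u)
  f := millCost (setsOf u) (elementsOf u) (incidence u)
  pairing := millCost_isPairing _ _ _
  symmetric := millCost_isSymmetric _ _ _
  k := weightOf u + 1
  p := 9
  pathwidth_le := pathwidth_millGraph_le _ _ (setsOf_pos u)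

/-- `millInst` is a legal instance for every word, so the program need not check that its input
encodes a formula. -/
theorem polyList_encode_millInst : PolyList (fun u => (millInst u).encode) := by
  have hn : PolyComp (fun u (_ : Unit) =>
      2 * (setsOf u * elementsOf u) + 5 + elementsOf u) :=
    .add ((PolyComp.const_mul 2 polyComp_cells).add_const 5) polyComp_elementsOf
  have hadj : PolyPred (fun w (y : (Unit × ℕ) × ℕ) =>
      decide (Link (setsOf w) (setsOf w * elementsOf w) (incidence w) y.1.2 y.2) = true) :=
    (polyPred_link PolyComp.last.weaken .last).congr fun w x => by simp
  have key := (PolyList.encNat hn).append ((PolyList.encNat (polyComp_weightOf.add_const 1)).append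
    ((PolyList.encNat (.const 9)).append ((PolyList.table₂ (b := fun w u v =>
      decide (Link (setsOf w) (setsOf w * elementsOf w) (incidence w) u v)) hn hadj).append
      (PolyList.table₃ (b := fun w => cost (setsOf w) (setsOf w * elementsOf w) (incidence w)) hn
        (polyPred_cost PolyComp.last.weaken.weaken PolyComp.last.weaken .last)))))
  convert key using 2 with u
  unfold DiscreteMillingInst.encode millInst
  simp only [millGraph]
  congr!
  exact decide_eq_decide.2 Iff.rfl

theorem isSatisfiable_iff {q : ℕ} (I : CNFInst q) :
    I.IsSatisfiable ↔ HasCoveringWalk (millInst I.encode).G (millInst I.encode).f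
      (millInst I.encode).k := by
  obtain ⟨h1, h2, h3, h4⟩ := parse_encode I
  have h5 := cover_iff (w := I.weight) (fun j => I.clauses.getD j []) h4
  have h6 : (millInst I.encode).k = I.weight + 1 := congrArg (· + 1) h2
  rw [h6]
  refine Iff.trans ?_ (hasCoveringWalk_iff (setsOf_pos I.encode)).symm
  simp only [incidence, decide_eq_true_eq, setsOf, elementsOf, h1, h2, h3]
  rw [h5]
  refine exists_congr fun τ => and_congr_right fun _ => ?_
  rw [List.forall_mem_iff_forall_getElem]
  refine forall₂_congr fun j hj => ?_
  simp [List.getD, hj]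

end

end Milling

theorem mainTheorem3 : Milling.IsW1Hard Milling.discreteMilling := by
  rintro A ⟨q, hA⟩
  refine hA.trans_polyList (fun I => Milling.millInst I.encode) (k := 10)
    Milling.polyList_encode_millInst (fun _ => rfl) Milling.isSatisfiable_iff fun I => ?_
  have h : Milling.weightOf I.encode = I.weight := (Milling.parse_encode I).2.1
  -- `w + 1` turns and pathwidth bound `9`.
  change Milling.weightOf I.encode + 1 + 9 ≤ I.weight + 10
  omega
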